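/- \textbf{Setting.} Let $d\ge 1$ and let $x_1,x_2,\dots$ be i.i.d. points in $\mathbb R^d$ with law $\mu$ having a Lebesgue density $p$. Let $S=\{x:\langle n_S,x\rangle=b\}$, $\|n_S\|=1$, be a hyperplane with closed halfspaces $H^+=\{\langle n_S,x\rangle\ge b\}$ and $H^-=\{\langle n_S,x\rangle\le b\}$. Assume: (i) $p$ vanishes outside a compact set $C$ and $0<p_{\min}\le p\le p_{\max}$ on $C$; (ii) in the interior of $C$, $p$ is twice differentiable with $\|\nabla p\|\le p_{\max}'$; (iii) $\mu(H^+)>0$ and $\mu(H^-)>0$; (iv) if $d\ge 2$, then $\partial C$ is an embedded hypersurface of class $C^2$ (being compact, it has bounded principal curvatures), there are $\gamma,r_\gamma>0$ with $\mathcal L_d(B(x,r)\cap C)\ge\gamma\,\mathcal L_d(B(x,r))$ for all $x\in C$, $0<r\le r_\gamma$, and there is $\theta\in(0,\pi/2)$ with $|\langle n_S,n_x\rangle|\le\cos\theta$ for all $x\in S\cap\partial C$, where $n_x$ is a unit normal of $\partial C$ at $x$; (v) if $d=1$, then the point $S$ lies in the interior of $C$. For a bandwidth $\sigma>0$, let $G_n$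 be the complete graph without loops on $x_1,\dots,x_n$ with weights $w(x_i,x_j)=(2\pi\sigma^2)^{-d/2}\exp(-\|x_i-x_j\|^2/(2\sigma^2))$, $i\ne j$. Put $$\mathrm{cut}_n=2\sum_{x_i\in H^+,\,x_j\in H^-}w(x_i,x_j),\qquad \mathrm{vol}_n(H)=\sum_{x_i\in H}\sum_{j\neq i}w(x_i,x_j),$$ $$\mathrm{Ncut}_n=\mathrm{cut}_n\Big(\tfrac1{\mathrm{vol}_n(H^+)}+\tfrac1{\mathrm{vol}_n(H^-)}\Big),\qquad \mathrm{CheegerCut}_n=\frac{\mathrm{cut}_n}{\min\{\mathrm{vol}_n(H^+),\mathrm{vol}_n(H^-)\}},$$ $$\mathrm{CutLim}=\frac{2}{\sqrt{2\pi}}\int_S p^2(s)\,\mathrm ds,\qquad \mathrm{VolLim}(H)=\int_H p^2(x)\,\mathrm dx,$$ $$\mathrm{NCutLim}=\frac{\mathrm{CutLim}}{\mathrm{VolLim}(H^+)}+\frac{\mathrm{CutLim}}{\mathrm{VolLim}(H^-)},\qquad \mathrm{CheegerCutLim}=\frac{\mathrm{CutLim}}{\min\{\mathrm{VolLim}(H^+),\mathrm{VolLim}(H^-)\}},$$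 where $\int_S$ is the $(d-1)$-dimensional surface integral (evaluation at the point $S$ if $d=1$). Let $s_n^{\mathrm{cut}}=n^2\sigma_n$, $s_n^{\mathrm{vol}}=n^2$, and let $\Delta_n=\big|\frac{s_n^{\mathrm{vol}}}{s_n^{\mathrm{cut}}}\mathrm{XCut}_n-\mathrm{XCutLim}\big|$, where $(\mathrm{XCut}_n,\mathrm{XCutLim})$ is $(\mathrm{Ncut}_n,\mathrm{NCutLim})$ or $(\mathrm{CheegerCut}_n,\mathrm{CheegerCutLim})$ and $G_n$ is taken with bandwidth $\sigma_n$. The following holds for both choices. \textbf{Convergence.} If $\sigma_n>0$, $\sigma_n\to0$ and $n\sigma_n^{d+1}/\log n\to\infty$, then almost surely $\Delta_n\to0$. Assume in addition, if $d=1$, that $\partial C$ is finite, and let $\alpha\in(0,1)$. \textbf{Rate.} For every $\sigma_0>0$ and $\sigma_n=\sigma_0(\log n/n)^{1/(d+3)}$, almost surely $\Delta_n=O\big((\log n/n)^{\alpha/(d+3)}\big)$, with a non-random constant. \textbf{Optimality of this choice for the error bound.} For all $\sigma_n>0$ with $\sigma_n\to0$ and $n\sigma_n^{d+1}/\log n\to\infty$,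 almost surely $$\Delta_n=O\Big(\sigma_n^{\alpha}+\sqrt{\log n/(n\sigma_n^{d+1})}\Big)$$ with a non-random constant, while for every $n\ge2$ and every $\sigma>0$ one has $\sigma^\alpha+\sqrt{\log n/(n\sigma^{d+1})}\ge(\log n/n)^{1/(d+3)}$. That is, no choice of bandwidth gives a bound of this form with an exponent of $\log n/n$ larger than $1/(d+3)$, and the choice above attains every smaller exponent. -/

import Mathlib

open MeasureTheory ProbabilityTheory Filter Topology

noncomputable section

namespace NcutLimit

/-! ### Weighted graphs, cut, volume, Ncut and Cheeger cut -/

section Graph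

variable {V : Type*}

/-- The cut between the two parts `U` and `W` of a partition of the vertices of a graph with
weights `w` (as for directed graphs, both orientations of a pair are counted). -/
def cut (w : V → V → ℝ) (U W : Finset V) : ℝ :=
  ∑ u ∈ U, ∑ v ∈ W, (w u v + w v u)

/-- The volume of a set `U` of vertices. -/
def vol [Fintype V] (w : V → V → ℝ) (U : Finset V) : ℝ :=
  ∑ u ∈ U, ∑ v, w u v

/-- The normalized cut of the partition `(U, W)`. -/
def ncut [Fintype V] (w : V → V → ℝ) (U W : Finset V) : ℝ :=
  cut w U W * (1 / vol w U + 1 / vol w W)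

/-- The Cheeger cut of the partition `(U, W)`. -/
def cheegerCut [Fintype V] (w : V → V → ℝ) (U W : Finset V) : ℝ :=
  cut w U W / min (vol w U) (vol w W)

end Graph

/-- `ℝ^d` with the Euclidean norm. -/
abbrev E (d : ℕ) : Type := EuclideanSpace ℝ (Fin d)

/-! ### The hyperplane and its closed halfspaces -/

/-- The hyperplane with unit normal `ν` and offset `b`. -/
def hyperplane {d : ℕ} (ν : E d) (b : ℝ) : Set (E d) := {x | inner ℝ ν x = b}

/-- The closed halfspace into which `ν` points. -/
def halfPos {d : ℕ} (ν : E d) (b : ℝ) : Set (E d) := {x | b ≤ inner ℝ ν x}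

/-- The opposite closed halfspace. -/
def halfNeg {d : ℕ} (ν : E d) (b : ℝ) : Set (E d) := {x | inner ℝ ν x ≤ b}

/-- The `(d-1)`-dimensional surface integral of `g` along the hyperplane with unit normal `ν` and
offset `b`: integration against the `(d-1)`-dimensional Hausdorff measure, normalized to agree with
Lebesgue measure on isometric copies of `ℝ^(d-1)` (the counting measure if `d = 1`). -/
def hyperplaneIntegral {d : ℕ} (ν : E d) (b : ℝ) (g : E d → ℝ) : ℝ :=
  ∫ x in hyperplane ν b, g x ∂(Measure.euclideanHausdorffMeasure (d - 1))

/-! ### The complete graph with Gaussian weights on sample points -/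

/-- The Gaussian weight function with bandwidth `s` in dimension `d`. -/
def gaussWeight (d : ℕ) (s u : ℝ) : ℝ :=
  1 / (2 * Real.pi * s ^ 2) ^ ((d : ℝ) / 2) * Real.exp (-(1 / 2) * (u ^ 2 / s ^ 2))

open Classical in
/-- Weights of the complete graph (without loops) on `x_1, …, x_n`. -/
def completeWeight {d n : ℕ} (s : ℝ) (x : Fin n → E d) (i j : Fin n) : ℝ :=
  if i = j then 0 else gaussWeight d s (dist (x i) (x j))

open Classical in
/-- The (indices of the) sample points that lie in `H`. -/
def pointsIn {d n : ℕ} (x : Fin n → E d) (H : Set (E d)) : Finset (Fin n) :=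
  Finset.univ.filter fun i => x i ∈ H

/-- `Ncut_n` of the partition induced by the hyperplane. -/
def ncutSample {d n : ℕ} (ν : E d) (b s : ℝ) (x : Fin n → E d) : ℝ :=
  ncut (completeWeight s x) (pointsIn x (halfPos ν b)) (pointsIn x (halfNeg ν b))

/-- `CheegerCut_n` of the partition induced by the hyperplane. -/
def cheegerCutSample {d n : ℕ} (ν : E d) (b s : ℝ) (x : Fin n → E d) : ℝ :=
  cheegerCut (completeWeight s x) (pointsIn x (halfPos ν b)) (pointsIn x (halfNeg ν b))

/-! ### Scaling sequences and limits -/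

/-- Scaling of the cut. -/
def sCut (n : ℕ) (s : ℝ) : ℝ := (n : ℝ) ^ 2 * s

/-- Scaling of the volume. -/
def sVol (n : ℕ) : ℝ := (n : ℝ) ^ 2

/-- The limit of the rescaled cut. -/
def cutLim {d : ℕ} (p : E d → ℝ) (ν : E d) (b : ℝ) : ℝ :=
  2 / Real.sqrt (2 * Real.pi) * hyperplaneIntegral ν b fun x => p x ^ 2

/-- The limit of the rescaled volume of the points in `H`. -/
def volLim {d : ℕ} (p : E d → ℝ) (H : Set (E d)) : ℝ := ∫ x in H, p x ^ 2

/-- The limit of the rescaled normalized cut. -/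
def ncutLim {d : ℕ} (p : E d → ℝ) (ν : E d) (b : ℝ) : ℝ :=
  cutLim p ν b / volLim p (halfPos ν b) + cutLim p ν b / volLim p (halfNeg ν b)

/-- The limit of the rescaled Cheeger cut. -/
def cheegerCutLim {d : ℕ} (p : E d → ℝ) (ν : E d) (b : ℝ) : ℝ :=
  cutLim p ν b / min (volLim p (halfPos ν b)) (volLim p (halfNeg ν b))

/-- `Δ_n` for the normalized cut. -/
def ncutDev {d n : ℕ} (p : E d → ℝ) (ν : E d) (b s : ℝ) (x : Fin n → E d) : ℝ :=
  |sVol n / sCut n s * ncutSample ν b s x - ncutLim p ν b|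

/-- `Δ_n` for the Cheeger cut. -/
def cheegerCutDev {d n : ℕ} (p : E d → ℝ) (ν : E d) (b s : ℝ) (x : Fin n → E d) : ℝ :=
  |sVol n / sCut n s * cheegerCutSample ν b s x - cheegerCutLim p ν b|

/-! ### Hypersurfaces and their normals -/

/-- `g` is a local `C²` defining function with nonvanishing gradient of the set `M` at `x`. -/
def IsLocalDefining {d : ℕ} (M : Set (E d)) (x : E d) (g : E d → ℝ) : Prop :=
  gradient g x ≠ 0 ∧
    ∃ U : Set (E d), IsOpen U ∧ x ∈ U ∧ ContDiffOn ℝ 2 g U ∧ M ∩ U = {y ∈ U | g y = 0}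

/-- `M` is an (embedded, boundaryless) hypersurface of class `C²`. If `M` is compact, its principal
curvatures are then automatically bounded. -/
def IsHypersurface {d : ℕ} (M : Set (E d)) : Prop :=
  ∀ x ∈ M, ∃ g : E d → ℝ, IsLocalDefining M x g

/-- `v` is one of the two unit normals of the hypersurface `M` at `x`. -/
def IsUnitNormal {d : ℕ} (M : Set (E d)) (x v : E d) : Prop :=
  ‖v‖ = 1 ∧ ∃ g : E d → ℝ, IsLocalDefining M x g ∧ ∃ c : ℝ, v = c • gradient g x

/-! ### General assumptions -/

/-- The measure on `ℝ^d` with Lebesgue density `p`. -/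
def densityMeasure {d : ℕ} (p : E d → ℝ) : Measure (E d) :=
  volume.withDensity fun x => ENNReal.ofReal (p x)

/-- The general assumptions on the density `p`, its support `C`, and the cut hyperplane with
unit normal `ν` and offset `b`. -/
structure GeneralAssumptions {d : ℕ} (p : E d → ℝ) (C : Set (E d)) (ν : E d) (b : ℝ) : Prop where
  measurable : Measurable p
  isProbability : IsProbabilityMeasure (densityMeasure p)
  isCompact : IsCompact C
  eq_zero : ∀ x, x ∉ C → p x = 0
  bounds : ∃ pmin pmax : ℝ, 0 < pmin ∧ ∀ x ∈ C, pmin ≤ p x ∧ p x ≤ pmax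
  differentiable : DifferentiableOn ℝ p (interior C)
  differentiable_gradient : DifferentiableOn ℝ (gradient p) (interior C)
  gradient_bounded : ∃ pmax' : ℝ, ∀ x ∈ interior C, ‖gradient p x‖ ≤ pmax'
  norm_normal : ‖ν‖ = 1
  mass_pos : 0 < densityMeasure p (halfPos ν b)
  mass_neg : 0 < densityMeasure p (halfNeg ν b)
  boundary : 2 ≤ d → IsHypersurface (frontier C)
  ball_volume : 2 ≤ d → ∃ γ rγ : ℝ, 0 < γ ∧ 0 < rγ ∧ ∀ r, 0 < r → r ≤ rγ → ∀ x ∈ C,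
    ENNReal.ofReal γ * volume (Metric.closedBall x r) ≤ volume (Metric.closedBall x r ∩ C)
  transversal : 2 ≤ d → ∃ θ : ℝ, 0 < θ ∧ θ < Real.pi / 2 ∧
    ∀ x ∈ hyperplane ν b ∩ frontier C, ∀ v, IsUnitNormal (frontier C) x v →
      |inner ℝ ν v| ≤ Real.cos θ
  interior_of_dim_one : d = 1 → hyperplane ν b ⊆ interior C

end NcutLimit

end

/-!
The rescaled cut and the rescaled volumes are, up to the factor `1 - 1 / n`, U-statistics of order
two whose kernels depend on the bandwidth `s`; both cuts are smooth functions of these three numbers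
because the two limiting volumes are positive. So it suffices to bound the bias and the deviation of
each U-statistic.

*Deviation.* For `s ≤ 1` the kernels take values between `0` and `M = 2 / s ^ (d + 1)`, and they have
bounded mean, so their variance is `O(M)`. A U-statistic is an average, over all permutations, of means of `n / 2`
independent terms; Jensen's inequality transfers the exponential moment bound of a bounded variable
(`mgf_offDiagSum_le`), and the Chernoff bound and the Borel–Cantelli lemma give a deviation of order
`√(M log n / n)` (`ae_eventually_abs_offDiagSum_sub_le`).

*Bias.* After the change of variables `y = x + z`, the expectations are integrals of the Gaussian in
`z` against the correlation `overlap p A B z` of the density with itself at lag `z`. Where the ball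
of radius `|z|` around `x` misses `∂C`, the density is Lipschitz on it; the remaining points form a
tube around `∂C`. For the volumes the tube has volume `O(|z|)`, hence the correlation is
`∫ p² + O(|z|)`. For the cut, the correlation at lag `z` only sees a slab of thickness
`-⟨ν, z⟩ ≤ |z|` along the hyperplane, whose slices meet the tube in measure `O(|z|)` by
transversality; hence it is `max (-⟨ν, z⟩) 0 · ∫_S p² + O(|z|²)` (`exists_overlap_half_le`).
Integration against the Gaussian gives biases `O(s)`. The tube estimates (`exists_volume_tube_le`)
only use a strictly differentiable local defining function: two points of the tube on a line along
which this function is steep are close, so about `1 / r` disjoint translates of the tube of radius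
`r` fit into a bounded region.

In dimension one without finiteness of `∂C`, tubes around `∂C` need not be small, and the volumes
are handled by continuity of translations in `L¹` (`tendsto_vol_bias`), which gives no rate; the
cut is not affected because the cut point is interior to `C`.
-/

namespace NcutLimit

/-! ### Orthogonal coordinates and the volume of tubes -/

/-- Orthogonal coordinates adapted to the unit vector `ν`: an isometric copy `J` of `ℝ^k` as the
orthogonal complement of `ν`, such that `(t, u) ↦ t ν + J u` preserves Lebesgue measure. -/
theorem exists_orthogonal_coordinates {k : ℕ} {ν : E (k + 1)} (hν : ‖ν‖ = 1) :
    ∃ J : E k →ₗᵢ[ℝ] E (k + 1), (∀ u, inner ℝ ν (J u) = 0) ∧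
      (∀ x, inner ℝ ν x = 0 → ∃ u, J u = x) ∧
      MeasurePreserving (fun q : ℝ × E k => q.1 • ν + J q.2) ∧
      MeasurableEmbedding (fun q : ℝ × E k => q.1 • ν + J q.2) := by
  have hν0 : ν ≠ 0 := by
    rintro rfl
    simp at hν
  have hfin : Module.finrank ℝ (ℝ ∙ ν)ᗮ = k := by
    have : Fact (Module.finrank ℝ (E (k + 1)) = k + 1) := ⟨by simp⟩
    exact Submodule.finrank_orthogonal_span_singleton hν0
  let e : E k ≃ₗᵢ[ℝ] (ℝ ∙ ν)ᗮ :=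
    ((stdOrthonormalBasis ℝ (ℝ ∙ ν)ᗮ).reindex (finCongr hfin)).repr.symm
  let J : E k →ₗᵢ[ℝ] E (k + 1) := (ℝ ∙ ν)ᗮ.subtypeₗᵢ.comp e.toLinearIsometry
  have hJ : ∀ u, inner ℝ ν (J u) = 0 := fun u =>
    Submodule.mem_orthogonal_singleton_iff_inner_right.mp (e u).2
  let L : WithLp 2 (ℝ × E k) →ₗᵢ[ℝ] E (k + 1) :=
    { toFun := fun q => q.fst • ν + J q.snd
      map_add' := fun q r => by
        simp only [WithLp.add_fst, WithLp.add_snd, add_smul, map_add]; abel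
      map_smul' := fun c q => by
        simp [smul_smul]
      norm_map' := fun q => by
        have h1 : ‖q.fst • ν + J q.snd‖ ^ 2 = ‖q‖ ^ 2 := by
          rw [norm_add_sq_real, WithLp.prod_norm_sq_eq_of_L2, inner_smul_left, hJ, norm_smul, hν,
            J.norm_map]
          simp
        exact (sq_eq_sq₀ (norm_nonneg _) (norm_nonneg _)).mp h1 }
  let Le : WithLp 2 (ℝ × E k) ≃ₗᵢ[ℝ] E (k + 1) := L.toLinearIsometryEquiv (by
    rw [(WithLp.linearEquiv 2 ℝ (ℝ × E k)).finrank_eq]; simp [add_comm])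
  refine ⟨J, hJ, fun x hx => ?_, ?_, ?_⟩
  · refine ⟨e.symm ⟨x, Submodule.mem_orthogonal_singleton_iff_inner_right.mpr hx⟩, ?_⟩
    change ((e (e.symm _) : (ℝ ∙ ν)ᗮ) : E (k + 1)) = x
    rw [e.apply_symm_apply]
  · exact Le.measurePreserving.comp (WithLp.volume_preserving_toLp ℝ (E k))
  · exact Le.toHomeomorph.measurableEmbedding.comp
      (MeasurableEquiv.toLp 2 (ℝ × E k)).measurableEmbedding

/-- In orthogonal coordinates the surface integral is a Lebesgue integral over `ℝ^k`. -/
theorem hyperplaneIntegral_eq {k : ℕ} {ν : E (k + 1)} (hν : ‖ν‖ = 1) {J : E k →ₗᵢ[ℝ] E (k + 1)}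
    (hJ : ∀ u, inner ℝ ν (J u) = 0) (hJs : ∀ x, inner ℝ ν x = 0 → ∃ u, J u = x) (b : ℝ)
    (g : E (k + 1) → ℝ) : hyperplaneIntegral ν b g = ∫ u, g (b • ν + J u) := by
  have hiso : Isometry fun u => b • ν + J u :=
    (IsometryEquiv.constVAdd (b • ν)).isometry.comp J.isometry
  have hrange : Set.range (fun u => b • ν + J u) = hyperplane ν b := by
    ext x
    constructor
    · rintro ⟨u, rfl⟩
      simp [hyperplane, inner_add_right, inner_smul_right, hJ, hν]
    · intro hx
      obtain ⟨u, hu⟩ := hJs (x - b • ν) (by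
        rw [inner_sub_right, inner_smul_right, real_inner_self_eq_norm_sq, hν, hx]; ring)
      exact ⟨u, by simp [hu]⟩
  unfold hyperplaneIntegral
  rw [← hrange, ← hiso.map_euclideanHausdorffMeasure, Nat.add_sub_cancel,
    hiso.isClosedEmbedding.measurableEmbedding.integral_map,
    EuclideanSpace.euclideanHausdorffMeasure_eq_volume]

/-- Pigeonhole with translates: if no two points of the bounded measurable set `A` differ by a
positive multiple `≥ τ` of `e`, then the volume of `A` is `O(τ)`, because about `1 / τ` disjoint
translates of `A` fit into a bounded region. -/
theorem volume_le_of_disjoint_translates {m : ℕ} {A : Set (E m)} (hA : MeasurableSet A)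
    {u₀ e : E m} {R τ : ℝ} (hAR : A ⊆ Metric.closedBall u₀ R) (hτ : 0 < τ)
    (h : ∀ u ∈ A, ∀ c : ℝ, τ ≤ c → u + c • e ∉ A) :
    volume A ≤ ENNReal.ofReal (τ * (volume (Metric.closedBall u₀ (R + ‖e‖))).toReal) := by
  set N : ℕ := ⌊1 / τ⌋₊
  set V := volume (Metric.closedBall u₀ (R + ‖e‖))
  have hV : V ≠ ⊤ := measure_closedBall_lt_top.ne
  let T : ℕ → Set (E m) := fun j => (fun x => x + (-((j : ℝ) * τ)) • e) ⁻¹' A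
  have hT : ∀ j, volume (T j) = volume A := fun j => measure_preimage_add_right _ _ _
  have hTm : ∀ j, MeasurableSet (T j) := fun j => hA.preimage (measurable_add_const _)
  have key : ∀ i j : ℕ, i < j → Disjoint (T i) (T j) := by
    intro i j hij
    rw [Set.disjoint_left]
    intro x hi hj
    refine h _ hj (((j : ℝ) - i) * τ) ?_ ?_
    · have : (1 : ℝ) ≤ (j : ℝ) - i := by
        have : (i : ℝ) + 1 ≤ j := by exact_mod_cast hij
        linarith
      nlinarith
    · have : x + (-((j : ℝ) * τ)) • e + (((j : ℝ) - i) * τ) • e = x + (-((i : ℝ) * τ)) • e := by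
        module
      rw [this]
      exact hi
  have hdisj : ((Finset.range (N + 1) : Finset ℕ) : Set ℕ).PairwiseDisjoint T := by
    intro i _ j _ hij
    rcases lt_or_gt_of_ne hij with h | h
    · exact key i j h
    · exact (key j i h).symm
  have hsub : (⋃ j ∈ Finset.range (N + 1), T j) ⊆ Metric.closedBall u₀ (R + ‖e‖) := by
    intro x hx
    simp only [Set.mem_iUnion, Finset.mem_range] at hx
    obtain ⟨j, hj, hx⟩ := hx
    have h1 := hAR hx
    rw [Metric.mem_closedBall, dist_eq_norm] at h1 ⊢
    have hjτ : (j : ℝ) * τ ≤ 1 := by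
      have : (j : ℝ) ≤ 1 / τ := le_trans (by exact_mod_cast Nat.lt_succ_iff.mp hj)
        (Nat.floor_le (by positivity))
      rwa [le_div_iff₀ hτ] at this
    calc ‖x - u₀‖ = ‖(x + (-((j : ℝ) * τ)) • e - u₀) + ((j : ℝ) * τ) • e‖ := by congr 1; module
      _ ≤ R + ‖((j : ℝ) * τ) • e‖ := (norm_add_le _ _).trans (by gcongr)
      _ ≤ R + ‖e‖ := by
        rw [norm_smul, Real.norm_of_nonneg (by positivity)]
        nlinarith [norm_nonneg e]
  have hsum : ((N + 1 : ℕ) : ENNReal) * volume A ≤ V := by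
    calc ((N + 1 : ℕ) : ENNReal) * volume A = ∑ j ∈ Finset.range (N + 1), volume (T j) := by
          simp [hT]
      _ = volume (⋃ j ∈ Finset.range (N + 1), T j) :=
          (measure_biUnion_finset hdisj fun j _ => hTm j).symm
      _ ≤ V := measure_mono hsub
  have hAtop : volume A ≠ ⊤ := by
    intro hA'
    rw [hA', ENNReal.mul_top (by simp)] at hsum
    exact hV (top_le_iff.mp hsum)
  have hreal : ((N : ℝ) + 1) * (volume A).toReal ≤ V.toReal := by
    have := ENNReal.toReal_mono hV hsum
    rw [ENNReal.toReal_mul, ENNReal.toReal_natCast] at this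
    exact_mod_cast this
  rw [← ENNReal.ofReal_toReal hAtop]
  apply ENNReal.ofReal_le_ofReal
  have hN : 1 / τ ≤ (N : ℝ) + 1 := (Nat.lt_floor_add_one _).le
  have h2 : 1 / τ * (volume A).toReal ≤ V.toReal :=
    (mul_le_mul_of_nonneg_right hN ENNReal.toReal_nonneg).trans hreal
  rw [div_mul_eq_mul_div, one_mul, div_le_iff₀ hτ] at h2
  linarith

/-- Local form of the tube estimate: near a point of `Z` with a strictly differentiable local
defining function whose derivative along the slice does not vanish. -/
theorem exists_volume_tube_le_local {m d : ℕ} (a : E d) (J : E m →ₗᵢ[ℝ] E d) {Z : Set (E d)}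
    (hZ : IsCompact Z) (u₀ : E m) {f : E d → ℝ} {f' : E d →L[ℝ] ℝ}
    (hf : HasStrictFDerivAt f f' (a + J u₀)) (hfZ : ∀ᶠ y in 𝓝 (a + J u₀), y ∈ Z → f y = 0)
    (hne : ∃ e, f' (J e) ≠ 0) :
    ∃ W ∈ 𝓝 u₀, ∃ K r₀ : ℝ, 0 ≤ K ∧ 0 < r₀ ∧ ∀ r, 0 < r → r < r₀ →
      volume ({u | a + J u ∈ Metric.cthickening r Z} ∩ W) ≤ ENNReal.ofReal (K * r) := by
  obtain ⟨e, he⟩ : ∃ e, 0 < f' (J e) := by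
    obtain ⟨e, he⟩ := hne
    rcases lt_or_gt_of_ne he with h | h
    · exact ⟨-e, by simpa using h⟩
    · exact ⟨e, h⟩
  set c₀ := f' (J e)
  set c : NNReal := ⟨c₀ / (2 * (‖e‖ + 1)), by positivity⟩ with hc
  have hcpos : 0 < c := by
    rw [← NNReal.coe_pos]; change 0 < c₀ / (2 * (‖e‖ + 1)); positivity
  have hce : (c : ℝ) * ‖e‖ ≤ c₀ / 2 := by
    change c₀ / (2 * (‖e‖ + 1)) * ‖e‖ ≤ c₀ / 2
    rw [div_mul_eq_mul_div, div_le_div_iff₀ (by positivity) (by positivity)]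
    nlinarith [norm_nonneg e]
  obtain ⟨s, hs, happ⟩ := hf.approximates_deriv_on_nhds (Or.inr hcpos)
  obtain ⟨ρ, hρ, hball⟩ := Metric.mem_nhds_iff.mp (Filter.inter_mem hs hfZ)
  set Lc : ℝ := ‖f'‖ + c
  have hL : 0 ≤ Lc := by positivity
  -- along `e` the function grows with slope at least `c₀ / 2`, while `|f| ≤ Lc * r` on the tube
  set l : ℝ := 4 * Lc / c₀ + 1
  have hl : 0 < l := by positivity
  refine ⟨Metric.ball u₀ (ρ / 2), Metric.ball_mem_nhds _ (by positivity),
    l * (volume (Metric.closedBall u₀ (ρ / 2 + ‖e‖))).toReal, ρ / 2, by positivity,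
    by positivity, fun r hr hrρ => ?_⟩
  have hdist : ∀ u, dist (a + J u) (a + J u₀) = dist u u₀ := fun u => by
    rw [dist_add_left, J.dist_map]
  have hfsmall : ∀ u ∈ {u | a + J u ∈ Metric.cthickening r Z} ∩ Metric.ball u₀ (ρ / 2),
      a + J u ∈ s ∧ |f (a + J u)| ≤ Lc * r := by
    rintro u ⟨hu, hub⟩
    rw [Metric.mem_ball] at hub
    rw [Set.mem_ofPred_eq, hZ.cthickening_eq_biUnion_closedBall hr.le] at hu
    simp only [Set.mem_iUnion, Metric.mem_closedBall] at hu
    obtain ⟨y, hyZ, hy⟩ := hu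
    have hus : a + J u ∈ Metric.ball (a + J u₀) ρ := by
      rw [Metric.mem_ball, hdist]; linarith
    have hys : y ∈ Metric.ball (a + J u₀) ρ := by
      rw [Metric.mem_ball]
      calc dist y (a + J u₀) ≤ dist y (a + J u) + dist (a + J u) (a + J u₀) := dist_triangle _ _ _
        _ < ρ := by rw [dist_comm y, hdist]; linarith
    refine ⟨(hball hus).1, ?_⟩
    have hy0 : f y = 0 := (hball hys).2 hyZ
    have h1 := happ _ (hball hus).1 _ (hball hys).1
    rw [dist_eq_norm] at hy
    rw [hy0, sub_zero] at h1
    calc |f (a + J u)| = ‖(f (a + J u) - f' (a + J u - y)) + f' (a + J u - y)‖ := by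
          rw [sub_add_cancel, Real.norm_eq_abs]
      _ ≤ c * ‖a + J u - y‖ + ‖f'‖ * ‖a + J u - y‖ :=
          (norm_add_le _ _).trans (add_le_add h1 (f'.le_opNorm _))
      _ = Lc * ‖a + J u - y‖ := by ring
      _ ≤ Lc * r := by gcongr
  refine (volume_le_of_disjoint_translates (u₀ := u₀) (e := e) (R := ρ / 2) (τ := l * r) ?_ ?_
    (by positivity) ?_).trans (le_of_eq (by congr 1; ring))
  · refine MeasurableSet.inter ?_ measurableSet_ball
    exact (Metric.isClosed_cthickening.preimage
      (continuous_const.add J.continuous)).measurableSet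
  · exact Set.inter_subset_right.trans Metric.ball_subset_closedBall
  · intro u hu τ hτ hu'
    have hτ0 : 0 < τ := lt_of_lt_of_le (by positivity) hτ
    obtain ⟨h1s, h1⟩ := hfsmall _ hu
    obtain ⟨h2s, h2⟩ := hfsmall _ hu'
    have h3 := happ _ h2s _ h1s
    have h4 : a + J (u + τ • e) - (a + J u) = τ • J e := by simp
    rw [h4, map_smul, norm_smul, J.norm_map, Real.norm_of_nonneg hτ0.le, smul_eq_mul,
      Real.norm_eq_abs] at h3
    have h5 := neg_le_of_abs_le h3
    have h6 := le_of_abs_le h2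
    have h7 := neg_le_of_abs_le h1
    change -((c : ℝ) * (τ * ‖e‖)) ≤ _ - τ * c₀ at h5
    have h8 : τ * c₀ / 2 ≤ 2 * Lc * r := by nlinarith
    have h9 : l * c₀ = 4 * Lc + c₀ := by
      simp only [l]; field_simp
    nlinarith [mul_pos hr he, mul_le_mul_of_nonneg_right hτ he.le]

/-- Tube estimate: the slice `a + J(ℝ^m)` meets the `r`-neighbourhood of the compact set `Z` in
a set of volume `O(r)`, if `Z` is locally contained in the zero set of a strictly differentiable
function that has nonzero derivative along the slice. -/
theorem exists_volume_tube_le {m d : ℕ} (a : E d) (J : E m →ₗᵢ[ℝ] E d) {Z : Set (E d)}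
    (hZ : IsCompact Z)
    (h : ∀ u, a + J u ∈ Z → ∃ f : E d → ℝ, ∃ f' : E d →L[ℝ] ℝ, HasStrictFDerivAt f f' (a + J u) ∧
      (∀ᶠ y in 𝓝 (a + J u), y ∈ Z → f y = 0) ∧ ∃ e, f' (J e) ≠ 0) :
    ∃ K r₀ : ℝ, 0 ≤ K ∧ 0 < r₀ ∧ ∀ r, 0 < r → r < r₀ →
      volume {u | a + J u ∈ Metric.cthickening r Z} ≤ ENNReal.ofReal (K * r) := by
  have hcont : Continuous fun u => a + J u := continuous_const.add J.continuous
  have hemb : IsClosedEmbedding fun u => a + J u :=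
    ((IsometryEquiv.constVAdd a).isometry.comp J.isometry).isClosedEmbedding
  have hD : IsCompact {u | a + J u ∈ Metric.cthickening 1 Z} :=
    hemb.isCompact_preimage hZ.cthickening
  have hind : ∃ K r₀ : ℝ, 0 ≤ K ∧ 0 < r₀ ∧ ∀ r, 0 < r → r < r₀ →
      volume ({u | a + J u ∈ Metric.cthickening r Z} ∩ {u | a + J u ∈ Metric.cthickening 1 Z}) ≤
        ENNReal.ofReal (K * r) := by
    refine hD.induction_on (p := fun s => ∃ K r₀ : ℝ, 0 ≤ K ∧ 0 < r₀ ∧ ∀ r, 0 < r → r < r₀ →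
      volume ({u | a + J u ∈ Metric.cthickening r Z} ∩ s) ≤ ENNReal.ofReal (K * r))
      ⟨0, 1, le_rfl, one_pos, by simp⟩ ?_ ?_ ?_
    · rintro s t hst ⟨K, r₀, hK, hr₀, H⟩
      exact ⟨K, r₀, hK, hr₀, fun r h1 h2 =>
        (measure_mono (Set.inter_subset_inter_right _ hst)).trans (H r h1 h2)⟩
    · rintro s t ⟨K, r₀, hK, hr₀, H⟩ ⟨K', r₀', hK', hr₀', H'⟩
      refine ⟨K + K', min r₀ r₀', by positivity, lt_min hr₀ hr₀', fun r h1 h2 => ?_⟩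
      rw [Set.inter_union_distrib_left, add_mul, ENNReal.ofReal_add (by positivity) (by positivity)]
      exact (measure_union_le _ _).trans (add_le_add
        (H r h1 (h2.trans_le (min_le_left _ _))) (H' r h1 (h2.trans_le (min_le_right _ _))))
    · intro u _
      by_cases hu : a + J u ∈ Z
      · obtain ⟨f, f', hf, hfZ, hne⟩ := h u hu
        obtain ⟨W, hW, H⟩ := exists_volume_tube_le_local a J hZ u hf hfZ hne
        exact ⟨W, mem_nhdsWithin_of_mem_nhds hW, H⟩
      · obtain ⟨ρ, hρ, hball⟩ := Metric.mem_nhds_iff.mp (hZ.isClosed.isOpen_compl.mem_nhds hu)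
        refine ⟨Metric.ball u (ρ / 2), mem_nhdsWithin_of_mem_nhds
          (Metric.ball_mem_nhds _ (by positivity)), 0, ρ / 2, le_rfl, by positivity, ?_⟩
        intro r hr hrρ
        have : {u | a + J u ∈ Metric.cthickening r Z} ∩ Metric.ball u (ρ / 2) = ∅ := by
          rw [Set.eq_empty_iff_forall_notMem]
          rintro v ⟨hv, hvb⟩
          rw [Set.mem_ofPred_eq, hZ.cthickening_eq_biUnion_closedBall hr.le] at hv
          simp only [Set.mem_iUnion, Metric.mem_closedBall] at hv
          obtain ⟨y, hyZ, hy⟩ := hv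
          refine hball (a := y) ?_ hyZ
          rw [Metric.mem_ball] at hvb ⊢
          calc dist y (a + J u) ≤ dist y (a + J v) + dist (a + J v) (a + J u) := dist_triangle _ _ _
            _ < ρ := by rw [dist_comm y, dist_add_left, J.dist_map]; linarith
        rw [this]
        simp
  obtain ⟨K, r₀, hK, hr₀, H⟩ := hind
  refine ⟨K, min r₀ 1, hK, lt_min hr₀ one_pos, fun r h1 h2 => ?_⟩
  have hsub : {u | a + J u ∈ Metric.cthickening r Z} ⊆
      {u | a + J u ∈ Metric.cthickening r Z} ∩ {u | a + J u ∈ Metric.cthickening 1 Z} :=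
    Set.subset_inter subset_rfl fun u hu =>
      Metric.cthickening_mono (h2.le.trans (min_le_right _ _)) Z hu
  exact (measure_mono hsub).trans (H r h1 (h2.trans_le (min_le_left _ _)))

/-! ### Regularity of the density -/

namespace GeneralAssumptions

variable {d : ℕ} {p : E d → ℝ} {C : Set (E d)} {ν : E d} {b : ℝ}

theorem exists_bound (hp : GeneralAssumptions p C ν b) :
    ∃ B : ℝ, 0 < B ∧ (∀ x, 0 ≤ p x) ∧ ∀ x, p x ≤ B := by
  obtain ⟨pmin, pmax, hmin, h⟩ := hp.bounds
  refine ⟨max pmax 1, by positivity, fun x => ?_, fun x => ?_⟩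
  · by_cases hx : x ∈ C
    · exact hmin.le.trans (h x hx).1
    · rw [hp.eq_zero x hx]
  · by_cases hx : x ∈ C
    · exact (h x hx).2.trans (le_max_left _ _)
    · rw [hp.eq_zero x hx]; positivity

theorem exists_radius (hp : GeneralAssumptions p C ν b) :
    ∃ R : ℝ, 0 < R ∧ ∀ x, p x ≠ 0 → ‖x‖ ≤ R := by
  obtain ⟨R, hR⟩ := hp.isCompact.isBounded.subset_closedBall 0
  refine ⟨max R 1, by positivity, fun x hx => ?_⟩
  have : x ∈ C := by
    by_contra h
    exact hx (hp.eq_zero x h)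
  simpa using Or.inl (mem_closedBall_zero_iff.mp (hR this))

theorem lintegral_eq_one (hp : GeneralAssumptions p C ν b) :
    ∫⁻ x, ENNReal.ofReal (p x) = 1 := by
  have := hp.isProbability.measure_univ
  rwa [densityMeasure, withDensity_apply _ MeasurableSet.univ, Measure.restrict_univ] at this

theorem integrable (hp : GeneralAssumptions p C ν b) : Integrable p := by
  obtain ⟨B, -, h0, -⟩ := hp.exists_bound
  refine ⟨hp.measurable.aestronglyMeasurable, ?_⟩
  rw [hasFiniteIntegral_iff_ofReal (ae_of_all _ h0), hp.lintegral_eq_one]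
  exact ENNReal.one_lt_top

theorem integral_eq_one (hp : GeneralAssumptions p C ν b) : ∫ x, p x = 1 := by
  obtain ⟨B, -, h0, -⟩ := hp.exists_bound
  rw [integral_eq_lintegral_of_nonneg_ae (ae_of_all _ h0) hp.measurable.aestronglyMeasurable,
    hp.lintegral_eq_one, ENNReal.toReal_one]

theorem isCompact_frontier (hp : GeneralAssumptions p C ν b) : IsCompact (frontier C) :=
  hp.isCompact.of_isClosed_subset isClosed_frontier hp.isCompact.isClosed.frontier_subset

/-- On a ball missing `∂C` the density is Lipschitz: the ball is connected, hence lies either in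
the interior of `C`, where the gradient is bounded, or outside `C`, where the density vanishes. -/
theorem exists_lipschitz (hp : GeneralAssumptions p C ν b) :
    ∃ L : ℝ, 0 ≤ L ∧ ∀ (x : E d) (r : ℝ), 0 ≤ r → x ∉ Metric.cthickening r (frontier C) →
      ∀ y ∈ Metric.closedBall x r, ∀ z ∈ Metric.closedBall x r, |p y - p z| ≤ L * dist y z := by
  obtain ⟨L, hL⟩ := hp.gradient_bounded
  refine ⟨max L 0, le_max_right _ _, fun x r hr hx y hy z hz => ?_⟩
  have hsub : Metric.closedBall x r ⊆ interior C ∪ (closure C)ᶜ := by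
    intro w hw
    by_contra h
    simp only [Set.mem_union, Set.mem_compl_iff, not_or, not_not] at h
    refine hx ?_
    rw [hp.isCompact_frontier.cthickening_eq_biUnion_closedBall hr]
    exact Set.mem_biUnion (x := w) ⟨h.2, h.1⟩ (Metric.mem_closedBall_comm.mp hw)
  have hconv : Convex ℝ (Metric.closedBall x r) := convex_closedBall x r
  have hdisj : Disjoint (interior C) (closure C)ᶜ :=
    Set.disjoint_compl_right_iff_subset.mpr (interior_subset.trans subset_closure)
  rcases hconv.isPreconnected.subset_or_subset isOpen_interior isClosed_closure.isOpen_compl hdisj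
    hsub with h | h
  · have hb : ∀ w ∈ Metric.closedBall x r, ‖fderiv ℝ p w‖ ≤ max L 0 := fun w hw => by
      have : ‖fderiv ℝ p w‖ = ‖gradient p w‖ := by
        rw [gradient, LinearIsometryEquiv.norm_map]
      rw [this]
      exact (hL w (h hw)).trans (le_max_left _ _)
    have := hconv.norm_image_sub_le_of_norm_fderiv_le (fun w hw =>
      hp.differentiable.differentiableAt (isOpen_interior.mem_nhds (h hw))) hb hz hy
    rwa [dist_eq_norm, ← Real.norm_eq_abs]
  · have h0 : ∀ w ∈ Metric.closedBall x r, p w = 0 := fun w hw =>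
      hp.eq_zero w fun hwC => h hw (subset_closure hwC)
    rw [h0 y hy, h0 z hz, sub_self, abs_zero]
    positivity

end GeneralAssumptions

/-- A function supported in a fixed ball that is bounded by `B` near `Z` and by `A r` at distance
`> r` from `Z` has integral `O(r)`, if the `r`-neighbourhoods of `Z` have volume `O(r)`. -/
theorem exists_abs_integral_le_of_tube {m d : ℕ} (a : E d) (J : E m →ₗᵢ[ℝ] E d) {Z : Set (E d)}
    (hZ : ∃ K r₀ : ℝ, 0 ≤ K ∧ 0 < r₀ ∧ ∀ r, 0 < r → r < r₀ →
      volume {u | a + J u ∈ Metric.cthickening r Z} ≤ ENNReal.ofReal (K * r)) (R A B : ℝ)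
    (hA : 0 ≤ A) (hB : 0 ≤ B) :
    ∃ K : ℝ, 0 ≤ K ∧ ∀ (f : E m → ℝ) (r : ℝ), 0 < r → (∀ u, R < ‖u‖ → f u = 0) →
      (∀ u, |f u| ≤ B) → (∀ u, a + J u ∉ Metric.cthickening r Z → |f u| ≤ A * r) →
      |∫ u, f u| ≤ K * r := by
  obtain ⟨K, r₀, hK, hr₀, hv⟩ := hZ
  set D : Set (E m) := Metric.closedBall 0 R with hD
  have hDt : volume D ≠ ⊤ := measure_closedBall_lt_top.ne
  have hDm : MeasurableSet D := measurableSet_closedBall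
  set V := (volume D).toReal with hV
  have hV0 : 0 ≤ V := ENNReal.toReal_nonneg
  refine ⟨A * V + B * K + B * V / r₀, by positivity, fun f r hr hsupp hfB hfA => ?_⟩
  have hint : ∀ (c : ℝ) (s : Set (E m)), MeasurableSet s → volume s ≠ ⊤ →
      Integrable (s.indicator fun _ => c) := fun c s hs hst =>
    (integrable_indicator_iff hs).mpr (integrableOn_const hst)
  have hval : ∀ (c : ℝ) (s : Set (E m)), MeasurableSet s →
      ∫ u, s.indicator (fun _ => c) u = (volume s).toReal * c := fun c s hs => by
    rw [integral_indicator hs, setIntegral_const, smul_eq_mul, Measure.real]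
  have hVD : 0 ≤ A * V * r ∧ 0 ≤ B * K * r ∧ 0 ≤ B * V / r₀ * r :=
    ⟨by positivity, by positivity, by positivity⟩
  rw [← Real.norm_eq_abs, add_mul, add_mul]
  rcases lt_or_ge r r₀ with hlt | hge
  · set T : Set (E m) := {u | a + J u ∈ Metric.cthickening r Z} with hT
    have hTm : MeasurableSet T := (Metric.isClosed_cthickening.preimage
      (continuous_const.add J.continuous)).measurableSet
    have hTv := hv r hr hlt
    have hTt : volume T ≠ ⊤ := ne_top_of_le_ne_top ENNReal.ofReal_ne_top hTv
    have hTr : (volume T).toReal ≤ K * r := ENNReal.toReal_le_of_le_ofReal (by positivity) hTv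
    have hle : ‖∫ u, f u‖ ≤ ∫ u, (D.indicator (fun _ => A * r) u + T.indicator (fun _ => B) u) := by
      refine norm_integral_le_of_norm_le ((hint _ _ hDm hDt).add (hint _ _ hTm hTt))
        (ae_of_all _ fun u => ?_)
      rw [Real.norm_eq_abs]
      have h1 : 0 ≤ D.indicator (fun _ => A * r) u :=
        Set.indicator_nonneg (fun _ _ => by positivity) u
      have h2 : 0 ≤ T.indicator (fun _ => B) u := Set.indicator_nonneg (fun _ _ => hB) u
      by_cases huT : u ∈ T
      · rw [Set.indicator_of_mem huT]
        linarith [hfB u]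
      · by_cases huD : u ∈ D
        · rw [Set.indicator_of_mem huD]
          linarith [hfA u huT]
        · rw [hsupp u (by simpa [hD] using huD), abs_zero]
          linarith
    rw [integral_add (hint _ _ hDm hDt) (hint _ _ hTm hTt), hval _ _ hDm, hval _ _ hTm] at hle
    have : (volume T).toReal * B ≤ K * r * B := by gcongr
    rw [← hV] at hle
    linarith [hVD.2.2]
  · have hle : ‖∫ u, f u‖ ≤ ∫ u, D.indicator (fun _ => B) u := by
      refine norm_integral_le_of_norm_le (hint _ _ hDm hDt) (ae_of_all _ fun u => ?_)
      rw [Real.norm_eq_abs]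
      by_cases huD : u ∈ D
      · rw [Set.indicator_of_mem huD]
        exact hfB u
      · rw [hsupp u (by simpa [hD] using huD), abs_zero]
        exact Set.indicator_nonneg (fun _ _ => hB) u
    rw [hval _ _ hDm, ← hV] at hle
    have : V * B ≤ B * V / r₀ * r := by
      rw [div_mul_eq_mul_div, le_div_iff₀ hr₀]
      nlinarith [mul_nonneg hV0 hB]
    linarith [hVD.1, hVD.2.1]

/-- Translation is continuous in `L¹`. -/
theorem tendsto_integral_abs_translate_sub {d : ℕ} {p : E d → ℝ} (hp : Integrable p) :
    Tendsto (fun z => ∫ x, |p (x + z) - p x|) (𝓝 0) (𝓝 0) := by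
  let g : E d → C(E d, E d) := fun z => ⟨fun x => x + z, by fun_prop⟩
  have hg : Continuous g :=
    ContinuousMap.continuous_of_continuous_uncurry _ (by
      change Continuous fun q : E d × E d => q.2 + q.1
      fun_prop)
  have hgm : ∀ z, MeasurePreserving (g z) volume volume := fun z =>
    measurePreserving_add_right volume z
  let f : Lp ℝ 1 (volume : Measure (E d)) := hp.toL1 p
  have hcont : Continuous fun z => Lp.compMeasurePreserving (g z) (hgm z) f :=
    continuous_const.compMeasurePreservingLp hg hgm ENNReal.one_ne_top
  have h0 : Lp.compMeasurePreserving (g 0) (hgm 0) f = f := by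
    apply Lp.ext
    refine (Lp.coeFn_compMeasurePreserving f (hgm 0)).trans (ae_of_all _ fun x => ?_)
    simp [g]
  have hlim : Tendsto (fun z => ‖Lp.compMeasurePreserving (g z) (hgm z) f - f‖) (𝓝 0) (𝓝 0) := by
    have := (hcont.sub (continuous_const (y := f))).norm.tendsto 0
    simpa [h0] using this
  refine hlim.congr fun z => ?_
  rw [L1.norm_eq_integral_norm]
  refine integral_congr_ae ?_
  have hf : f =ᵐ[volume] p := hp.coeFn_toL1
  filter_upwards [Lp.coeFn_sub (Lp.compMeasurePreserving (g z) (hgm z) f) f,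
    Lp.coeFn_compMeasurePreserving f (hgm z), hf, (hgm z).quasiMeasurePreserving.ae_eq_comp hf]
    with x h1 h2 h3 h4
  rw [h1, Pi.sub_apply, h2, h4, h3, Real.norm_eq_abs]
  rfl

/-! ### Tubes around the boundary of the support -/

theorem fderiv_eq_inner_gradient {d : ℕ} (g : E d → ℝ) (x v : E d) :
    fderiv ℝ g x v = inner ℝ (gradient g x) v := by
  rw [gradient, InnerProductSpace.toDual_symm_apply]

theorem IsLocalDefining.hasStrictFDerivAt {d : ℕ} {M : Set (E d)} {x : E d} {g : E d → ℝ}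
    (h : IsLocalDefining M x g) : HasStrictFDerivAt g (fderiv ℝ g x) x := by
  obtain ⟨-, U, hU, hx, hg, -⟩ := h
  exact (hg.contDiffAt (hU.mem_nhds hx)).hasStrictFDerivAt (by norm_num)

theorem IsLocalDefining.eventually_eq_zero {d : ℕ} {M : Set (E d)} {x : E d} {g : E d → ℝ}
    (h : IsLocalDefining M x g) : ∀ᶠ y in 𝓝 x, y ∈ M → g y = 0 := by
  obtain ⟨-, U, hU, hx, -, hM⟩ := h
  filter_upwards [hU.mem_nhds hx] with y hy hyM
  have : y ∈ M ∩ U := ⟨hyM, hy⟩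
  rw [hM] at this
  exact this.2

namespace GeneralAssumptions

/-- The `r`-neighbourhood of `∂C` has volume `O(r)`. -/
theorem exists_volume_frontier_tube_le {d : ℕ} (hd : 1 ≤ d) {p : E d → ℝ} {C : Set (E d)}
    {ν : E d} {b : ℝ} (hp : GeneralAssumptions p C ν b) (hfin : d = 1 → (frontier C).Finite) :
    ∃ K r₀ : ℝ, 0 ≤ K ∧ 0 < r₀ ∧ ∀ r, 0 < r → r < r₀ →
      volume {u | 0 + (LinearIsometry.id : E d →ₗᵢ[ℝ] E d) u ∈
        Metric.cthickening r (frontier C)} ≤ ENNReal.ofReal (K * r) := by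
  refine exists_volume_tube_le 0 LinearIsometry.id hp.isCompact_frontier fun u hu => ?_
  rcases hd.eq_or_lt with h1 | h2
  · subst h1
    -- a finite set coincides locally with the zero set of a coordinate function
    refine ⟨fun y => y 0 - (0 + (LinearIsometry.id : E 1 →ₗᵢ[ℝ] E 1) u) 0,
      EuclideanSpace.proj 0,
      (EuclideanSpace.proj (𝕜 := ℝ) (0 : Fin 1)).hasStrictFDerivAt.sub_const _,
      ?_, EuclideanSpace.single 0 1, by simp⟩
    set x := 0 + (LinearIsometry.id : E 1 →ₗᵢ[ℝ] E 1) u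
    have hcl : IsClosed (frontier C \ {x}) := ((hfin rfl).subset Set.sdiff_subset).isClosed
    filter_upwards [hcl.isOpen_compl.mem_nhds (x := x) (by simp)] with y hy hyC
    have : y = x := by
      by_contra hne
      exact hy ⟨hyC, hne⟩
    rw [this, sub_self]
  · obtain ⟨g, hg⟩ := hp.boundary h2 _ hu
    refine ⟨g, _, hg.hasStrictFDerivAt, hg.eventually_eq_zero,
      gradient g (0 + (LinearIsometry.id : E d →ₗᵢ[ℝ] E d) u), ?_⟩
    rw [fderiv_eq_inner_gradient]
    exact inner_self_ne_zero.mpr hg.1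

/-- Within the hyperplane, the `r`-neighbourhood of `∂C` has surface measure `O(r)`: by
transversality the gradient of a local defining function of `∂C` has a nonzero component along the
hyperplane. -/
theorem exists_volume_slice_tube_le {k : ℕ} {p : E (k + 1) → ℝ} {C : Set (E (k + 1))}
    {ν : E (k + 1)} {b : ℝ} (hp : GeneralAssumptions p C ν b) {J : E k →ₗᵢ[ℝ] E (k + 1)}
    (hJ : ∀ u, inner ℝ ν (J u) = 0) (hJs : ∀ x, inner ℝ ν x = 0 → ∃ u, J u = x) :
    ∃ K r₀ : ℝ, 0 ≤ K ∧ 0 < r₀ ∧ ∀ r, 0 < r → r < r₀ →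
      volume {u | b • ν + J u ∈ Metric.cthickening r (frontier C)} ≤ ENNReal.ofReal (K * r) := by
  refine exists_volume_tube_le (b • ν) J hp.isCompact_frontier fun u hu => ?_
  have hS : b • ν + J u ∈ hyperplane ν b := by
    simp [hyperplane, inner_add_right, inner_smul_right, hJ, hp.norm_normal]
  rcases Nat.eq_zero_or_pos k with h0 | hk
  · subst h0
    exact absurd hu fun h => h.2 (hp.interior_of_dim_one rfl hS)
  · have h2 : 2 ≤ k + 1 := by omega
    obtain ⟨g, hg⟩ := hp.boundary h2 _ hu
    obtain ⟨θ, h0θ, hθ, hcos⟩ := hp.transversal h2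
    set G := gradient g (b • ν + J u) with hG
    have hGpos : 0 < ‖G‖ := norm_pos_iff.mpr hg.1
    obtain ⟨e, he⟩ := hJs (G - (inner ℝ ν G) • ν) (by
      rw [inner_sub_right, inner_smul_right, real_inner_self_eq_norm_sq, hp.norm_normal]; ring)
    refine ⟨g, _, hg.hasStrictFDerivAt, hg.eventually_eq_zero, e, ?_⟩
    rw [fderiv_eq_inner_gradient, he, ← hG, inner_sub_right, inner_smul_right,
      real_inner_self_eq_norm_sq, real_inner_comm ν G]
    have hn := hcos _ ⟨hS, hu⟩ (‖G‖⁻¹ • G) ⟨by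
      rw [norm_smul, norm_inv, norm_norm, inv_mul_cancel₀ hGpos.ne'], g, hg, _, rfl⟩
    have hlt : Real.cos θ < 1 := by
      rw [← Real.cos_zero]
      exact Real.cos_lt_cos_of_nonneg_of_le_pi_div_two le_rfl hθ.le h0θ
    rw [inner_smul_right, abs_mul, abs_inv, abs_norm] at hn
    have h3 : |inner ℝ ν G| < ‖G‖ := by
      have := hn.trans_lt hlt
      rwa [inv_mul_lt_iff₀ hGpos, mul_one] at this
    have h4 := sq_lt_sq' (neg_lt_of_abs_lt h3) (lt_of_abs_lt h3)
    nlinarith [h4]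

end GeneralAssumptions

/-! ### Gaussian integrals -/

theorem gaussWeight_nonneg (d : ℕ) (s u : ℝ) : 0 ≤ gaussWeight d s u := by
  unfold gaussWeight; positivity

theorem gaussWeight_eq {d : ℕ} {s : ℝ} (u : ℝ) :
    gaussWeight d s u = ((2 * Real.pi * s ^ 2) ^ ((d : ℝ) / 2))⁻¹ *
      Real.exp (-(1 / (2 * s ^ 2)) * u ^ 2) := by
  unfold gaussWeight
  rw [one_div]
  congr 2
  ring

theorem gaussWeight_le {d : ℕ} {s : ℝ} (hs : 0 < s) (u : ℝ) : gaussWeight d s u ≤ 1 / s ^ d := by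
  unfold gaussWeight
  have h1 : s ^ d ≤ (2 * Real.pi * s ^ 2) ^ ((d : ℝ) / 2) := by
    calc s ^ d = (s ^ 2) ^ ((d : ℝ) / 2) := by
          rw [← Real.rpow_natCast s 2, ← Real.rpow_mul hs.le, ← Real.rpow_natCast]
          congr 1; push_cast; ring
      _ ≤ (2 * Real.pi * s ^ 2) ^ ((d : ℝ) / 2) := by
          gcongr
          nlinarith [Real.pi_gt_three, sq_nonneg s]
  have h2 : Real.exp (-(1 / 2) * (u ^ 2 / s ^ 2)) ≤ 1 := by
    rw [Real.exp_le_one_iff]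
    have : 0 ≤ u ^ 2 / s ^ 2 := by positivity
    linarith
  calc 1 / (2 * Real.pi * s ^ 2) ^ ((d : ℝ) / 2) * Real.exp (-(1 / 2) * (u ^ 2 / s ^ 2))
      ≤ 1 / (2 * Real.pi * s ^ 2) ^ ((d : ℝ) / 2) * 1 := by gcongr
    _ ≤ 1 / s ^ d := by rw [mul_one]; gcongr

theorem measurable_gaussWeight (d : ℕ) (s : ℝ) : Measurable (gaussWeight d s) := by
  unfold gaussWeight; fun_prop

theorem integral_gaussWeight (d : ℕ) {s : ℝ} (hs : 0 < s) :
    ∫ z : E d, gaussWeight d s ‖z‖ = 1 := by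
  simp_rw [gaussWeight_eq]
  rw [integral_const_mul, GaussianFourier.integral_rexp_neg_mul_sq_norm (by positivity)]
  have : Real.pi / (1 / (2 * s ^ 2)) = 2 * Real.pi * s ^ 2 := by field_simp
  rw [this, finrank_euclideanSpace_fin]
  exact inv_mul_cancel₀ (by positivity)

theorem integrable_gaussWeight (d : ℕ) {s : ℝ} (hs : 0 < s) :
    Integrable fun z : E d => gaussWeight d s ‖z‖ :=
  integrable_of_integral_eq_one (integral_gaussWeight d hs)

/-- `|z|² k_s(z)` is dominated by a multiple of the Gaussian of bandwidth `√2 s`. -/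
theorem sq_mul_gaussWeight_le {d : ℕ} {s : ℝ} (hs : 0 < s) (u : ℝ) :
    gaussWeight d s u * u ^ 2 ≤ 4 * 2 ^ ((d : ℝ) / 2) * s ^ 2 * gaussWeight d (√2 * s) u := by
  have h2 : (√2 * s) ^ 2 = 2 * s ^ 2 := by rw [mul_pow, Real.sq_sqrt (by norm_num)]
  rw [gaussWeight_eq, gaussWeight_eq, h2]
  have h3 : (2 * Real.pi * (2 * s ^ 2)) ^ ((d : ℝ) / 2) =
      2 ^ ((d : ℝ) / 2) * (2 * Real.pi * s ^ 2) ^ ((d : ℝ) / 2) := by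
    rw [← Real.mul_rpow (by norm_num) (by positivity)]
    congr 1; ring
  rw [h3]
  set c := (2 * Real.pi * s ^ 2) ^ ((d : ℝ) / 2)
  have hc : 0 < c := by positivity
  set q := (2 : ℝ) ^ ((d : ℝ) / 2)
  have hq : 0 < q := by positivity
  set y := 1 / (2 * (2 * s ^ 2)) * u ^ 2 with hy
  have e1 : -(1 / (2 * s ^ 2)) * u ^ 2 = -y + -y := by rw [hy]; field_simp; ring
  have e2 : -(1 / (2 * (2 * s ^ 2))) * u ^ 2 = -y := by rw [hy]; ring
  have e3 : u ^ 2 = 4 * s ^ 2 * y := by rw [hy]; field_simp; ring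
  rw [e1, e2, Real.exp_add]
  have h5 : y * Real.exp (-y) ≤ 1 := by
    rw [Real.exp_neg, ← div_eq_mul_inv, div_le_one (Real.exp_pos _)]
    linarith [Real.add_one_le_exp y]
  calc c⁻¹ * (Real.exp (-y) * Real.exp (-y)) * u ^ 2
      = 4 * s ^ 2 * c⁻¹ * Real.exp (-y) * (y * Real.exp (-y)) := by rw [e3]; ring
    _ ≤ 4 * s ^ 2 * c⁻¹ * Real.exp (-y) * 1 := by gcongr
    _ = 4 * q * s ^ 2 * ((q * c)⁻¹ * Real.exp (-y)) := by
        rw [mul_inv]; field_simp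

theorem integrable_gaussWeight_mul_sq (d : ℕ) {s : ℝ} (hs : 0 < s) :
    Integrable fun z : E d => gaussWeight d s ‖z‖ * ‖z‖ ^ 2 := by
  refine ((integrable_gaussWeight d (s := √2 * s) (by positivity)).const_mul
    (4 * 2 ^ ((d : ℝ) / 2) * s ^ 2)).mono' ?_ (ae_of_all _ fun z => ?_)
  · exact (((measurable_gaussWeight d s).comp measurable_norm).mul
      (measurable_norm.pow_const 2)).aestronglyMeasurable
  · rw [Real.norm_of_nonneg (mul_nonneg (gaussWeight_nonneg _ _ _) (by positivity))]
    exact sq_mul_gaussWeight_le hs _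

theorem integral_gaussWeight_mul_sq_le (d : ℕ) {s : ℝ} (hs : 0 < s) :
    ∫ z : E d, gaussWeight d s ‖z‖ * ‖z‖ ^ 2 ≤ 4 * 2 ^ ((d : ℝ) / 2) * s ^ 2 := by
  have hs2 : 0 < √2 * s := by positivity
  calc ∫ z : E d, gaussWeight d s ‖z‖ * ‖z‖ ^ 2
      ≤ ∫ z : E d, 4 * 2 ^ ((d : ℝ) / 2) * s ^ 2 * gaussWeight d (√2 * s) ‖z‖ :=
        integral_mono (integrable_gaussWeight_mul_sq d hs)
          ((integrable_gaussWeight d hs2).const_mul _) fun z => sq_mul_gaussWeight_le hs _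
    _ = 4 * 2 ^ ((d : ℝ) / 2) * s ^ 2 := by
        rw [integral_const_mul, integral_gaussWeight d hs2, mul_one]

theorem gaussWeight_mul_le {d : ℕ} {s : ℝ} (hs : 0 < s) {u : ℝ} :
    gaussWeight d s u * u ≤ s * gaussWeight d s u + s⁻¹ * (gaussWeight d s u * u ^ 2) := by
  have h1 : u ≤ s + s⁻¹ * u ^ 2 := by
    have : s + s⁻¹ * u ^ 2 - u = s⁻¹ * ((u - s / 2) ^ 2 + 3 / 4 * s ^ 2) := by field_simp; ring
    have h : 0 ≤ s⁻¹ * ((u - s / 2) ^ 2 + 3 / 4 * s ^ 2) := by positivity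
    linarith
  nlinarith [mul_le_mul_of_nonneg_left h1 (gaussWeight_nonneg d s u)]

theorem integrable_gaussWeight_mul_norm (d : ℕ) {s : ℝ} (hs : 0 < s) :
    Integrable fun z : E d => gaussWeight d s ‖z‖ * ‖z‖ := by
  refine (((integrable_gaussWeight d hs).const_mul s).add
    ((integrable_gaussWeight_mul_sq d hs).const_mul s⁻¹)).mono' ?_ (ae_of_all _ fun z => ?_)
  · exact (((measurable_gaussWeight d s).comp measurable_norm).mul
      measurable_norm).aestronglyMeasurable
  · rw [Real.norm_of_nonneg (mul_nonneg (gaussWeight_nonneg _ _ _) (by positivity))]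
    exact gaussWeight_mul_le hs

theorem integral_gaussWeight_mul_norm_le (d : ℕ) {s : ℝ} (hs : 0 < s) :
    ∫ z : E d, gaussWeight d s ‖z‖ * ‖z‖ ≤ (1 + 4 * 2 ^ ((d : ℝ) / 2)) * s := by
  have h1 := (integrable_gaussWeight d hs).const_mul s
  have h2 := (integrable_gaussWeight_mul_sq d hs).const_mul s⁻¹
  calc ∫ z : E d, gaussWeight d s ‖z‖ * ‖z‖
      ≤ ∫ z : E d, (s * gaussWeight d s ‖z‖ + s⁻¹ * (gaussWeight d s ‖z‖ * ‖z‖ ^ 2)) :=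
        integral_mono (integrable_gaussWeight_mul_norm d hs) (h1.add h2)
          fun z => gaussWeight_mul_le hs
    _ = s + s⁻¹ * ∫ z : E d, gaussWeight d s ‖z‖ * ‖z‖ ^ 2 := by
        rw [integral_add h1 h2, integral_const_mul, integral_const_mul, integral_gaussWeight d hs,
          mul_one]
    _ ≤ s + s⁻¹ * (4 * 2 ^ ((d : ℝ) / 2) * s ^ 2) := by
        gcongr
        exact integral_gaussWeight_mul_sq_le d hs
    _ = (1 + 4 * 2 ^ ((d : ℝ) / 2)) * s := by field_simp

theorem gaussWeight_add (k : ℕ) {s : ℝ} (hs : 0 < s) {t u v : ℝ} (h : v ^ 2 = t ^ 2 + u ^ 2) :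
    gaussWeight (k + 1) s v = gaussWeight 1 s t * gaussWeight k s u := by
  rw [gaussWeight_eq, gaussWeight_eq, gaussWeight_eq, h, mul_add, Real.exp_add]
  have : (2 * Real.pi * s ^ 2) ^ (((k + 1 : ℕ) : ℝ) / 2) =
      (2 * Real.pi * s ^ 2) ^ (((1 : ℕ) : ℝ) / 2) * (2 * Real.pi * s ^ 2) ^ ((k : ℝ) / 2) := by
    rw [← Real.rpow_add (by positivity)]
    congr 1; push_cast; ring
  rw [this, mul_inv]
  ring

theorem integral_gaussWeight_one_mul_max {s : ℝ} (hs : 0 < s) :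
    ∫ t : ℝ, gaussWeight 1 s t * max (-t) 0 = s / √(2 * Real.pi) := by
  rw [← integral_neg_eq_self]
  have h1 : (fun t : ℝ => gaussWeight 1 s (-t) * max (- -t) 0) =
      (Set.Ioi 0).indicator fun t => ((2 * Real.pi * s ^ 2) ^ (((1 : ℕ) : ℝ) / 2))⁻¹ *
        (t ^ (1 : ℝ) * Real.exp (-(1 / (2 * s ^ 2)) * t ^ (2 : ℝ))) := by
    funext t
    rw [gaussWeight_eq, neg_neg]
    by_cases ht : 0 < t
    · rw [Set.indicator_of_mem (Set.mem_Ioi.mpr ht), max_eq_left ht.le, Real.rpow_one,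
        Real.rpow_two, neg_sq]
      ring
    · rw [Set.indicator_of_notMem (by simpa using ht), max_eq_right (not_lt.mp ht), mul_zero]
  rw [h1, integral_indicator measurableSet_Ioi, integral_const_mul,
    integral_rpow_mul_exp_neg_mul_rpow (by norm_num) (by norm_num) (by positivity)]
  have e1 : -((1 : ℝ) + 1) / 2 = -1 := by norm_num
  have e2 : ((1 : ℝ) + 1) / 2 = 1 := by norm_num
  have e3 : (2 * Real.pi * s ^ 2) ^ (((1 : ℕ) : ℝ) / 2) = √(2 * Real.pi) * s := by
    rw [Nat.cast_one, ← Real.sqrt_eq_rpow, Real.sqrt_mul (by positivity), Real.sqrt_sq hs.le]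
  have hpi : 0 < √(2 * Real.pi) := by positivity
  rw [e1, e2, e3, Real.Gamma_one, Real.rpow_neg_one]
  field_simp

/-- First moment of the Gaussian across a hyperplane. -/
theorem integral_gaussWeight_mul_max {k : ℕ} {ν : E (k + 1)} (hν : ‖ν‖ = 1) {s : ℝ} (hs : 0 < s) :
    ∫ z : E (k + 1), gaussWeight (k + 1) s ‖z‖ * max (-inner ℝ ν z) 0 = s / √(2 * Real.pi) := by
  obtain ⟨J, hJ, -, hmp, hme⟩ := exists_orthogonal_coordinates hν
  rw [← hmp.integral_comp hme]
  have h1 : ∀ q : ℝ × E k, gaussWeight (k + 1) s ‖q.1 • ν + J q.2‖ *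
      max (-inner ℝ ν (q.1 • ν + J q.2)) 0 =
      (gaussWeight 1 s q.1 * max (-q.1) 0) * gaussWeight k s ‖q.2‖ := by
    rintro ⟨t, u⟩
    rw [gaussWeight_add k hs (t := t) (u := ‖u‖)]
    · simp only [inner_add_right, inner_smul_right, hJ, real_inner_self_eq_norm_sq, hν]
      ring_nf
    · rw [norm_add_sq_real, inner_smul_left, hJ, norm_smul, hν, J.norm_map]
      simp
  simp_rw [h1]
  rw [Measure.volume_eq_prod, integral_prod_mul (fun t => gaussWeight 1 s t * max (-t) 0)
    (fun u : E k => gaussWeight k s ‖u‖), integral_gaussWeight k hs, mul_one,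
    integral_gaussWeight_one_mul_max hs]

/-! ### Expectations of the U-statistics and bias of the volume -/

/-- The Gaussian interaction of a point `x ∈ A` with a point `y ∈ B`. -/
noncomputable def pairKernel {d : ℕ} (s : ℝ) (A B : Set (E d)) (x y : E d) : ℝ :=
  A.indicator 1 x * B.indicator 1 y * gaussWeight d s (dist x y)

/-- The correlation at lag `z` of the density restricted to `A` with the density restricted
to `B`. -/
noncomputable def overlap {d : ℕ} (p : E d → ℝ) (A B : Set (E d)) (z : E d) : ℝ :=
  ∫ x, A.indicator 1 x * B.indicator 1 (x + z) * (p x * p (x + z))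

theorem indicator_one_mem_Icc {α : Type*} (A : Set α) (x : α) :
    0 ≤ A.indicator (1 : α → ℝ) x ∧ A.indicator (1 : α → ℝ) x ≤ 1 := by
  by_cases h : x ∈ A <;> simp [h]

theorem indicator_mul_indicator_mem_Icc {α : Type*} (A B : Set α) (x y : α) :
    0 ≤ A.indicator (1 : α → ℝ) x * B.indicator (1 : α → ℝ) y ∧
      A.indicator (1 : α → ℝ) x * B.indicator (1 : α → ℝ) y ≤ 1 :=
  ⟨mul_nonneg (indicator_one_mem_Icc A x).1 (indicator_one_mem_Icc B y).1,
    mul_le_one₀ (indicator_one_mem_Icc A x).2 (indicator_one_mem_Icc B y).1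
      (indicator_one_mem_Icc B y).2⟩

theorem pairKernel_nonneg {d : ℕ} (s : ℝ) (A B : Set (E d)) (x y : E d) :
    0 ≤ pairKernel s A B x y :=
  mul_nonneg (indicator_mul_indicator_mem_Icc A B x y).1 (gaussWeight_nonneg _ _ _)

theorem pairKernel_le {d : ℕ} {s : ℝ} (hs : 0 < s) (A B : Set (E d)) (x y : E d) :
    pairKernel s A B x y ≤ 1 / s ^ d :=
  (mul_le_of_le_one_left (gaussWeight_nonneg _ _ _)
    (indicator_mul_indicator_mem_Icc A B x y).2).trans (gaussWeight_le hs _)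

theorem measurable_pairKernel {d : ℕ} (s : ℝ) {A B : Set (E d)} (hA : MeasurableSet A)
    (hB : MeasurableSet B) : Measurable fun q : E d × E d => pairKernel s A B q.1 q.2 := by
  unfold pairKernel
  exact (((measurable_one.indicator hA).comp measurable_fst).mul
    ((measurable_one.indicator hB).comp measurable_snd)).mul
    ((measurable_gaussWeight d s).comp (measurable_fst.dist measurable_snd))

theorem integral_densityMeasure {d : ℕ} {p : E d → ℝ} (hm : Measurable p) (h0 : ∀ x, 0 ≤ p x)
    (f : E d → ℝ) : ∫ x, f x ∂(densityMeasure p) = ∫ x, p x * f x := by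
  rw [densityMeasure, integral_withDensity_eq_integral_toReal_smul hm.ennreal_ofReal
    (ae_of_all _ fun _ => ENNReal.ofReal_lt_top)]
  exact integral_congr_ae (ae_of_all _ fun x => by simp [ENNReal.toReal_ofReal (h0 x)])

theorem measurableSet_halfPos {d : ℕ} (ν : E d) (b : ℝ) : MeasurableSet (halfPos ν b) :=
  measurableSet_le measurable_const (by fun_prop)

theorem measurableSet_halfNeg {d : ℕ} (ν : E d) (b : ℝ) : MeasurableSet (halfNeg ν b) :=
  measurableSet_le (by fun_prop) measurable_const

theorem integral_shear_left {d : ℕ} (p : E d → ℝ) (s : ℝ) (A B : Set (E d)) (z : E d) :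
    ∫ x, p x * (p (x + z) * pairKernel s A B x (x + z)) =
      gaussWeight d s ‖z‖ * overlap p A B z := by
  rw [overlap, ← integral_const_mul]
  refine integral_congr_ae (ae_of_all _ fun x => ?_)
  simp only [pairKernel, dist_self_add_right]
  ring

/-- Averaging a function of linear modulus of continuity at `0` against the Gaussian. -/
theorem abs_integral_gaussWeight_mul_sub_le {d : ℕ} {Φ : E d → ℝ} {s : ℝ} (hs : 0 < s)
    (hint : Integrable fun z => gaussWeight d s ‖z‖ * Φ z) {c ε K : ℝ} (hK : 0 ≤ K)
    (h : ∀ z, |Φ z - c| ≤ ε + K * ‖z‖) :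
    |(∫ z, gaussWeight d s ‖z‖ * Φ z) - c| ≤ ε + K * (1 + 4 * 2 ^ ((d : ℝ) / 2)) * s := by
  have hg := integrable_gaussWeight d hs
  have h1 : (∫ z, gaussWeight d s ‖z‖ * Φ z) - c =
      ∫ z, (gaussWeight d s ‖z‖ * Φ z - gaussWeight d s ‖z‖ * c) := by
    rw [integral_sub hint (hg.mul_const c), integral_mul_const, integral_gaussWeight d hs, one_mul]
  have h2 := (hg.const_mul ε).add ((integrable_gaussWeight_mul_norm d hs).const_mul K)
  rw [h1, ← Real.norm_eq_abs]
  refine (norm_integral_le_of_norm_le h2 (ae_of_all _ fun z => ?_)).trans ?_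
  · rw [← mul_sub, norm_mul, Real.norm_of_nonneg (gaussWeight_nonneg _ _ _), Real.norm_eq_abs]
    calc gaussWeight d s ‖z‖ * |Φ z - c| ≤ gaussWeight d s ‖z‖ * (ε + K * ‖z‖) :=
          mul_le_mul_of_nonneg_left (h z) (gaussWeight_nonneg _ _ _)
      _ = _ := by simp only [Pi.add_apply]; ring
  · simp only [Pi.add_apply]
    rw [integral_add (hg.const_mul ε) ((integrable_gaussWeight_mul_norm d hs).const_mul K),
      integral_const_mul, integral_const_mul, integral_gaussWeight d hs, mul_one, mul_assoc]
    gcongr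
    exact integral_gaussWeight_mul_norm_le d hs

namespace GeneralAssumptions

variable {d : ℕ} {p : E d → ℝ} {C : Set (E d)} {ν : E d} {b : ℝ}

theorem integrable_shear (hp : GeneralAssumptions p C ν b) {s : ℝ} (hs : 0 < s) {A B : Set (E d)}
    (hA : MeasurableSet A) (hB : MeasurableSet B) :
    Integrable (fun q : E d × E d => p q.1 * (p (q.1 + q.2) * pairKernel s A B q.1 (q.1 + q.2)))
      (volume.prod volume) := by
  obtain ⟨M, hM, h0, hle⟩ := hp.exists_bound
  have hadd : Measurable fun q : E d × E d => q.1 + q.2 := measurable_fst.add measurable_snd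
  refine (((hp.integrable.const_mul M).mul_prod (integrable_gaussWeight d hs))).mono' ?_
    (ae_of_all _ fun q => ?_)
  · exact ((hp.measurable.comp measurable_fst).mul ((hp.measurable.comp hadd).mul
      ((measurable_pairKernel s hA hB).comp (measurable_fst.prodMk hadd)))).aestronglyMeasurable
  · have h1 : pairKernel s A B q.1 (q.1 + q.2) ≤ gaussWeight d s ‖q.2‖ := by
      unfold pairKernel
      rw [dist_self_add_right]
      exact mul_le_of_le_one_left (gaussWeight_nonneg _ _ _)
        (indicator_mul_indicator_mem_Icc A B _ _).2
    have h2 := pairKernel_nonneg s A B q.1 (q.1 + q.2)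
    rw [Real.norm_of_nonneg (mul_nonneg (h0 _) (mul_nonneg (h0 _) h2))]
    calc p q.1 * (p (q.1 + q.2) * pairKernel s A B q.1 (q.1 + q.2))
        ≤ p q.1 * (M * gaussWeight d s ‖q.2‖) := by
          gcongr
          · exact h0 _
          · exact hle _
      _ = M * p q.1 * gaussWeight d s ‖q.2‖ := by ring

theorem integrable_gaussWeight_mul_overlap (hp : GeneralAssumptions p C ν b) {s : ℝ} (hs : 0 < s)
    {A B : Set (E d)} (hA : MeasurableSet A) (hB : MeasurableSet B) :
    Integrable fun z => gaussWeight d s ‖z‖ * overlap p A B z := by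
  simp_rw [← integral_shear_left]
  exact (hp.integrable_shear hs hA hB).integral_prod_right

theorem integral_pairKernel (hp : GeneralAssumptions p C ν b) {s : ℝ} (hs : 0 < s)
    {A B : Set (E d)} (hA : MeasurableSet A) (hB : MeasurableSet B) :
    ∫ q, pairKernel s A B q.1 q.2 ∂((densityMeasure p).prod (densityMeasure p)) =
      ∫ z, gaussWeight d s ‖z‖ * overlap p A B z := by
  obtain ⟨M, hM, h0, hle⟩ := hp.exists_bound
  have := hp.isProbability
  have hint : Integrable (fun q : E d × E d => pairKernel s A B q.1 q.2)
      ((densityMeasure p).prod (densityMeasure p)) :=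
    (integrable_const (1 / s ^ d)).mono' (measurable_pairKernel s hA hB).aestronglyMeasurable
      (ae_of_all _ fun q => by
        rw [Real.norm_of_nonneg (pairKernel_nonneg _ _ _ _ _)]
        exact pairKernel_le hs _ _ _ _)
  rw [integral_prod _ hint, integral_densityMeasure hp.measurable h0]
  simp_rw [integral_densityMeasure hp.measurable h0, ← integral_shear_left]
  rw [← integral_integral_swap (hp.integrable_shear hs hA hB)]
  refine integral_congr_ae (ae_of_all _ fun x => ?_)
  simp only
  rw [integral_const_mul, integral_add_left_eq_self (fun y => p y * pairKernel s A B x y) x]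

theorem integrable_overlap_integrand (hp : GeneralAssumptions p C ν b) {A B : Set (E d)}
    (hA : MeasurableSet A) (hB : MeasurableSet B) (z : E d) :
    Integrable fun x => A.indicator 1 x * B.indicator 1 (x + z) * (p x * p (x + z)) := by
  obtain ⟨M, hM, h0, hle⟩ := hp.exists_bound
  refine (hp.integrable.mul_const M).mono' ?_ (ae_of_all _ fun x => ?_)
  · exact (((measurable_one.indicator hA).mul ((measurable_one.indicator hB).comp
      (measurable_add_const z))).mul (hp.measurable.mul
      (hp.measurable.comp (measurable_add_const z)))).aestronglyMeasurable
  · have h1 := indicator_mul_indicator_mem_Icc A B x (x + z)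
    rw [Real.norm_of_nonneg (mul_nonneg h1.1 (mul_nonneg (h0 _) (h0 _)))]
    calc _ ≤ 1 * (p x * p (x + z)) := mul_le_mul_of_nonneg_right h1.2 (mul_nonneg (h0 _) (h0 _))
      _ ≤ p x * M := by rw [one_mul]; exact mul_le_mul_of_nonneg_left (hle _) (h0 _)

theorem overlap_univ_sub_volLim (hp : GeneralAssumptions p C ν b) {H : Set (E d)}
    (hH : MeasurableSet H) (z : E d) :
    overlap p H Set.univ z - volLim p H = ∫ x, H.indicator 1 x * (p x * (p (x + z) - p x)) := by
  have h1 := hp.integrable_overlap_integrand hH MeasurableSet.univ z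
  have h2 := hp.integrable_overlap_integrand hH MeasurableSet.univ 0
  have h3 : volLim p H =
      ∫ x, H.indicator 1 x * Set.univ.indicator 1 (x + 0) * (p x * p (x + 0)) := by
    rw [volLim, ← integral_indicator hH]
    refine integral_congr_ae (ae_of_all _ fun x => ?_)
    by_cases hx : x ∈ H <;> simp [hx, pow_two]
  rw [overlap, h3, ← integral_sub h1 h2]
  refine integral_congr_ae (ae_of_all _ fun x => ?_)
  simp
  ring

/-- The bias of the rescaled volume is `O(s)`, because tubes around `∂C` have volume `O(r)`. -/
theorem exists_vol_bias_le (hd : 1 ≤ d) (hp : GeneralAssumptions p C ν b)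
    (hfin : d = 1 → (frontier C).Finite) {H : Set (E d)} (hH : MeasurableSet H) :
    ∃ K : ℝ, 0 ≤ K ∧ ∀ s, 0 < s →
      |(∫ z, gaussWeight d s ‖z‖ * overlap p H Set.univ z) - volLim p H| ≤ K * s := by
  obtain ⟨M, hM, h0, hle⟩ := hp.exists_bound
  obtain ⟨R, hR, hRp⟩ := hp.exists_radius
  obtain ⟨L, hL, hLip⟩ := hp.exists_lipschitz
  obtain ⟨K, hK, hKi⟩ := exists_abs_integral_le_of_tube 0 LinearIsometry.id
    (hp.exists_volume_frontier_tube_le hd hfin) R (M * L) (M * M) (by positivity) (by positivity)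
  have hΦ : ∀ z, |overlap p H Set.univ z - volLim p H| ≤ 0 + K * ‖z‖ := by
    intro z
    rw [hp.overlap_univ_sub_volLim hH, zero_add]
    rcases (norm_nonneg z).eq_or_lt with hz | hz
    · rw [norm_eq_zero.mp hz.symm]
      simp
    · have hind := indicator_one_mem_Icc H
      have habs : ∀ x c, |p x - p (x + z)| ≤ c →
          |H.indicator 1 x * (p x * (p (x + z) - p x))| ≤ M * c := fun x c hc => by
        have hc0 : 0 ≤ c := (abs_nonneg _).trans hc
        rw [abs_mul, abs_mul, abs_of_nonneg (hind x).1, abs_of_nonneg (h0 x), abs_sub_comm]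
        calc _ ≤ 1 * (M * c) := by
              gcongr
              · exact mul_nonneg (h0 x) (abs_nonneg _)
              · exact (hind x).2
              · exact hle x
          _ = M * c := one_mul _
      refine hKi _ _ hz (fun x hx => ?_) (fun x => habs _ _ ?_) (fun x hx => ?_)
      · have : p x = 0 := by
          by_contra h
          exact absurd (hRp x h) (not_le.mpr hx)
        simp [this]
      · rw [abs_le]
        constructor <;> linarith [h0 x, h0 (x + z), hle x, hle (x + z)]
      · rw [mul_assoc]
        refine habs _ _ ?_
        have := hLip x ‖z‖ hz.le (by simpa using hx) x (by simp) (x + z) (by simp)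
        simpa using this
  exact ⟨K * (1 + 4 * 2 ^ ((d : ℝ) / 2)), by positivity, fun s hs =>
    (abs_integral_gaussWeight_mul_sub_le hs
      (hp.integrable_gaussWeight_mul_overlap hs hH MeasurableSet.univ) hK hΦ).trans
      (le_of_eq (zero_add _))⟩

/-- Without any regularity of `∂C`, the bias of the rescaled volume still vanishes. -/
theorem tendsto_vol_bias (hp : GeneralAssumptions p C ν b) {H : Set (E d)}
    (hH : MeasurableSet H) {σ : ℕ → ℝ} (hσ : ∀ᶠ n in atTop, 0 < σ n)
    (hσ0 : Tendsto σ atTop (𝓝 0)) :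
    Tendsto (fun n => |(∫ z, gaussWeight d (σ n) ‖z‖ * overlap p H Set.univ z) - volLim p H|)
      atTop (𝓝 0) := by
  obtain ⟨M, hM, h0, hle⟩ := hp.exists_bound
  have htr : ∀ z, Integrable fun x => p (x + z) := fun z => hp.integrable.comp_add_right z
  have hΦ : ∀ z, |overlap p H Set.univ z - volLim p H| ≤ M * ∫ x, |p (x + z) - p x| := by
    intro z
    rw [hp.overlap_univ_sub_volLim hH, ← integral_const_mul, ← Real.norm_eq_abs]
    refine norm_integral_le_of_norm_le (((htr z).sub hp.integrable).abs.const_mul M)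
      (ae_of_all _ fun x => ?_)
    have hind := indicator_one_mem_Icc H x
    rw [Real.norm_eq_abs, abs_mul, abs_mul, abs_of_nonneg hind.1, abs_of_nonneg (h0 x)]
    calc _ ≤ 1 * (M * |p (x + z) - p x|) := by
          gcongr
          · exact mul_nonneg (h0 x) (abs_nonneg _)
          · exact hind.2
          · exact hle x
      _ = _ := one_mul _
  have hbd : ∀ z, ∫ x, |p (x + z) - p x| ≤ 2 := by
    intro z
    have hz : ∫ x, p (x + z) = 1 := by
      rw [integral_add_right_eq_self p z, hp.integral_eq_one]
    calc ∫ x, |p (x + z) - p x| ≤ ∫ x, (p (x + z) + p x) := by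
          refine integral_mono ((htr z).sub hp.integrable).abs ((htr z).add hp.integrable)
            fun x => ?_
          rw [abs_le]
          constructor <;> linarith [h0 x, h0 (x + z)]
      _ = 2 := by
          rw [integral_add (htr z) hp.integrable, hz, hp.integral_eq_one]; norm_num
  rw [Metric.tendsto_atTop']
  intro ε hε
  obtain ⟨δ, hδ, hball⟩ := Metric.tendsto_nhds_nhds.mp
    (tendsto_integral_abs_translate_sub hp.integrable) (ε / (2 * M)) (by positivity)
  have hlin : ∀ z, |overlap p H Set.univ z - volLim p H| ≤ ε / 2 + 2 * M / δ * ‖z‖ := by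
    intro z
    rcases lt_or_ge ‖z‖ δ with hz | hz
    · have := hball (x := z) (by simpa using hz)
      rw [Real.dist_eq, sub_zero] at this
      have h1 := lt_of_abs_lt this
      have h2 : M * ∫ x, |p (x + z) - p x| ≤ M * (ε / (2 * M)) := by gcongr
      have h3 : M * (ε / (2 * M)) = ε / 2 := by field_simp
      have h4 : 0 ≤ 2 * M / δ * ‖z‖ := by positivity
      linarith [hΦ z]
    · have h1 : 2 * M ≤ 2 * M / δ * ‖z‖ := by
        rw [div_mul_eq_mul_div, le_div_iff₀ hδ]
        gcongr
      have h2 : M * ∫ x, |p (x + z) - p x| ≤ M * 2 := by gcongr; exact hbd z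
      linarith [hΦ z]
  set K := 2 * M / δ * (1 + 4 * 2 ^ ((d : ℝ) / 2))
  have hK : 0 < K := by positivity
  have hsmall : ∀ᶠ n in atTop, σ n < ε / (2 * K) := hσ0.eventually_lt_const (by positivity)
  obtain ⟨N, hN⟩ := eventually_atTop.mp (hσ.and hsmall)
  refine ⟨N, fun n hn => ?_⟩
  obtain ⟨h1, h2⟩ := hN n hn.le
  rw [Real.dist_eq, sub_zero, abs_abs]
  have h3 := abs_integral_gaussWeight_mul_sub_le h1
    (hp.integrable_gaussWeight_mul_overlap h1 hH MeasurableSet.univ) (by positivity) hlin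
  have h4 : K * σ n < ε / 2 := by
    rw [lt_div_iff₀ (by positivity)] at h2
    linarith
  exact lt_of_le_of_lt h3 (by linarith)

end GeneralAssumptions

/-! ### Bias of the cut -/

theorem integrable_of_bounded_of_support {m : ℕ} {f : E m → ℝ} (hf : Measurable f) {B R : ℝ}
    (hB : ∀ u, |f u| ≤ B) (hR : ∀ u, R < ‖u‖ → f u = 0) : Integrable f := by
  have hint : Integrable ((Metric.closedBall (0 : E m) R).indicator fun _ => B) :=
    (integrable_indicator_iff measurableSet_closedBall).mpr
      (integrableOn_const measure_closedBall_lt_top.ne)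
  refine hint.mono' hf.aestronglyMeasurable (ae_of_all _ fun u => ?_)
  by_cases hu : u ∈ Metric.closedBall (0 : E m) R
  · rw [Set.indicator_of_mem hu]
    exact hB u
  · rw [Set.indicator_of_notMem hu, hR u (by simpa using hu), norm_zero]

namespace GeneralAssumptions

variable {k : ℕ} {p : E (k + 1) → ℝ} {C : Set (E (k + 1))} {ν : E (k + 1)} {b : ℝ}

/-- In orthogonal coordinates, the overlap of the two halfspaces at lag `z` only involves the slab
`b ≤ t ≤ b - ⟨ν, z⟩`. -/
theorem overlap_half_eq (hp : GeneralAssumptions p C ν b) {J : E k →ₗᵢ[ℝ] E (k + 1)}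
    (hJ : ∀ u, inner ℝ ν (J u) = 0)
    (hmp : MeasurePreserving (fun q : ℝ × E k => q.1 • ν + J q.2))
    (hme : MeasurableEmbedding (fun q : ℝ × E k => q.1 • ν + J q.2)) (z : E (k + 1)) :
    Integrable ((Set.Icc b (b + -inner ℝ ν z)).indicator fun t =>
        ∫ u, p (t • ν + J u) * p (t • ν + J u + z)) ∧
      overlap p (halfPos ν b) (halfNeg ν b) z =
        ∫ t, (Set.Icc b (b + -inner ℝ ν z)).indicator
          (fun t => ∫ u, p (t • ν + J u) * p (t • ν + J u + z)) t := by
  have hF := (hmp.integrable_comp_emb hme).mpr (hp.integrable_overlap_integrand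
    (measurableSet_halfPos ν b) (measurableSet_halfNeg ν b) z)
  rw [Measure.volume_eq_prod] at hF
  have hslab : ∀ t : ℝ, ∫ u : E k, (halfPos ν b).indicator 1 (t • ν + J u) *
      (halfNeg ν b).indicator 1 (t • ν + J u + z) *
        (p (t • ν + J u) * p (t • ν + J u + z)) =
      (Set.Icc b (b + -inner ℝ ν z)).indicator
        (fun t => ∫ u, p (t • ν + J u) * p (t • ν + J u + z)) t := by
    intro t
    have hpos : ∀ u, t • ν + J u ∈ halfPos ν b ↔ b ≤ t := fun u => by
      simp [halfPos, inner_add_right, inner_smul_right, hJ, hp.norm_normal]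
    have hneg : ∀ u, t • ν + J u + z ∈ halfNeg ν b ↔ t ≤ b + -inner ℝ ν z := fun u => by
      simp only [halfNeg, Set.mem_ofPred_eq, inner_add_right, inner_smul_right, hJ,
        real_inner_self_eq_norm_sq, hp.norm_normal]
      constructor <;> intro h <;> linarith
    by_cases h1 : b ≤ t <;> by_cases h2 : t ≤ b + -inner ℝ ν z
    · rw [Set.indicator_of_mem (Set.mem_Icc.mpr ⟨h1, h2⟩)]
      refine integral_congr_ae (ae_of_all _ fun u => ?_)
      simp only
      rw [Set.indicator_of_mem ((hpos u).mpr h1), Set.indicator_of_mem ((hneg u).mpr h2)]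
      simp
    all_goals
      rw [Set.indicator_of_notMem fun h => by first | exact h1 h.1 | exact h2 h.2]
      refine (integral_congr_ae (ae_of_all _ fun u => ?_)).trans (integral_zero _ _)
      first
      | rw [Set.indicator_of_notMem (fun h => h1 ((hpos u).mp h)), zero_mul, zero_mul]
      | rw [Set.indicator_of_notMem (fun h => h2 ((hneg u).mp h)), mul_zero, zero_mul]
  constructor
  · refine hF.integral_prod_left.congr (ae_of_all _ fun t => ?_)
    exact hslab t
  · rw [overlap, ← hmp.integral_comp hme, Measure.volume_eq_prod]
    refine (integral_prod _ hF).trans ?_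
    exact integral_congr_ae (ae_of_all _ fun t => hslab t)

/-- To leading order, the overlap of the two halfspaces at lag `z` is the extent of `z` across the
hyperplane times the surface integral of `p²`. -/
theorem exists_overlap_half_le (hp : GeneralAssumptions p C ν b) :
    ∃ K : ℝ, 0 ≤ K ∧ ∀ z, |overlap p (halfPos ν b) (halfNeg ν b) z -
      (hyperplaneIntegral ν b fun x => p x ^ 2) * max (-inner ℝ ν z) 0| ≤ K * ‖z‖ ^ 2 := by
  obtain ⟨M, hM, h0, hle⟩ := hp.exists_bound
  obtain ⟨R, hR, hRp⟩ := hp.exists_radius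
  obtain ⟨L, hL, hLip⟩ := hp.exists_lipschitz
  obtain ⟨J, hJ, hJs, hmp, hme⟩ := exists_orthogonal_coordinates hp.norm_normal
  obtain ⟨K, hK, hKi⟩ := exists_abs_integral_le_of_tube (b • ν) J
    (hp.exists_volume_slice_tube_le hJ hJs) R (2 * M * L) (M * M) (by positivity) (by positivity)
  refine ⟨2 * K, by positivity, fun z => ?_⟩
  set w := -inner ℝ ν z with hw
  have hwz : w ≤ ‖z‖ := by
    have := abs_real_inner_le_norm ν z
    rw [hp.norm_normal, one_mul] at this
    linarith [neg_le_of_abs_le this]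
  obtain ⟨hint, hov⟩ := hp.overlap_half_eq hJ hmp hme z
  rw [← hw] at hint hov
  rw [hyperplaneIntegral_eq hp.norm_normal hJ hJs, hov]
  set G : ℝ → ℝ := fun t => ∫ u, p (t • ν + J u) * p (t • ν + J u + z) with hG
  set I : ℝ := ∫ u, p (b • ν + J u) ^ 2 with hI
  have hfar : ∀ (t : ℝ) (u : E k), R < ‖u‖ → p (t • ν + J u) = 0 := by
    intro t u hu
    by_contra h
    have h1 := hRp _ h
    have h2 : ‖t • ν + J u‖ ^ 2 = t ^ 2 + ‖u‖ ^ 2 := by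
      rw [norm_add_sq_real, inner_smul_left, hJ, norm_smul, hp.norm_normal, J.norm_map]
      simp
    nlinarith [sq_nonneg t, norm_nonneg (t • ν + J u), norm_nonneg u]
  have hmeas : ∀ (t : ℝ) (y : E (k + 1)), Measurable fun u => p (t • ν + J u + y) := fun t y =>
    hp.measurable.comp (by fun_prop)
  have hprod : ∀ (t : ℝ) (y : E (k + 1)),
      Integrable fun u => p (t • ν + J u) * p (t • ν + J u + y) := fun t y => by
    refine integrable_of_bounded_of_support (B := M * M) (R := R) ?_ (fun u => ?_) fun u hu => ?_
    · exact (show Measurable fun u => p (t • ν + J u) by simpa using hmeas t 0).mul (hmeas t y)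
    · rw [abs_of_nonneg (mul_nonneg (h0 _) (h0 _))]
      exact mul_le_mul (hle _) (hle _) (h0 _) hM.le
    · rw [hfar t u hu, zero_mul]
  have hGI : ∀ t ∈ Set.Icc b (b + w), |G t - I| ≤ K * (2 * ‖z‖) := by
    rintro t ⟨ht1, ht2⟩
    have hsub : G t - I =
        ∫ u, (p (t • ν + J u) * p (t • ν + J u + z) - p (b • ν + J u) * p (b • ν + J u + 0)) := by
      rw [integral_sub (hprod t z) (hprod b 0)]
      simp only [hG, hI, add_zero, pow_two]
    rw [hsub]
    rcases (norm_nonneg z).eq_or_lt with hz | hz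
    · have hz0 : z = 0 := norm_eq_zero.mp hz.symm
      have : t = b := by linarith
      rw [hz0, this]
      simp
    · refine hKi _ _ (by positivity) (fun u hu => ?_) (fun u => ?_) fun u hu => ?_
      · rw [hfar t u hu, hfar b u hu]
        simp
      · have a1 := mul_le_mul (hle (t • ν + J u)) (hle (t • ν + J u + z)) (h0 _) hM.le
        have a2 := mul_le_mul (hle (b • ν + J u)) (hle (b • ν + J u + 0)) (h0 _) hM.le
        have a3 := mul_nonneg (h0 (t • ν + J u)) (h0 (t • ν + J u + z))
        have a4 := mul_nonneg (h0 (b • ν + J u)) (h0 (b • ν + J u + 0))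
        rw [abs_le]
        constructor <;> linarith
      · rw [add_zero]
        have hd1 : dist (t • ν + J u) (b • ν + J u) ≤ ‖z‖ := by
          rw [dist_add_right, dist_eq_norm, ← sub_smul, norm_smul, hp.norm_normal, mul_one,
            Real.norm_of_nonneg (by linarith)]
          linarith
        have hd2 : dist (t • ν + J u + z) (b • ν + J u) ≤ 2 * ‖z‖ := by
          calc _ ≤ dist (t • ν + J u + z) (t • ν + J u) + dist (t • ν + J u) (b • ν + J u) :=
                dist_triangle _ _ _
            _ ≤ ‖z‖ + ‖z‖ := by
                gcongr
                simp
            _ = 2 * ‖z‖ := by ring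
        have hb0 : b • ν + J u ∈ Metric.closedBall (b • ν + J u) (2 * ‖z‖) :=
          Metric.mem_closedBall_self (by positivity)
        have l1 := hLip _ _ (by positivity) hu (t • ν + J u)
          (Metric.mem_closedBall.mpr (hd1.trans (by linarith))) _ hb0
        have l2 := hLip _ _ (by positivity) hu (t • ν + J u + z)
          (Metric.mem_closedBall.mpr hd2) _ hb0
        have l1' := l1.trans (mul_le_mul_of_nonneg_left (hd1.trans (by linarith :
          ‖z‖ ≤ 2 * ‖z‖)) hL)
        have l2' := l2.trans (mul_le_mul_of_nonneg_left hd2 hL)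
        generalize p (t • ν + J u + z) = c at *
        have hc := h0 (b • ν + J u)
        have hc' := hle (b • ν + J u)
        have hta := h0 (t • ν + J u)
        have htb := hle (t • ν + J u)
        generalize p (b • ν + J u) = e at *
        generalize p (t • ν + J u) = a at *
        calc |a * c - e * e| = |a * (c - e) + e * (a - e)| := by congr 1; ring
          _ ≤ |a * (c - e)| + |e * (a - e)| := abs_add_le _ _
          _ = a * |c - e| + e * |a - e| := by
              rw [abs_mul, abs_mul, abs_of_nonneg hta, abs_of_nonneg hc]
          _ ≤ M * (L * (2 * ‖z‖)) + M * (L * (2 * ‖z‖)) := by gcongr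
          _ = 2 * M * L * (2 * ‖z‖) := by ring
  have hvol : (volume (Set.Icc b (b + w))).toReal = max w 0 := by
    rw [Real.volume_Icc, add_sub_cancel_left, ENNReal.toReal_ofReal']
  have hconst : ∀ c : ℝ, Integrable ((Set.Icc b (b + w)).indicator fun _ => c) := fun c =>
    (integrable_indicator_iff measurableSet_Icc).mpr (integrableOn_const (by simp))
  have hval : ∀ c : ℝ, ∫ t, (Set.Icc b (b + w)).indicator (fun _ => c) t = c * max w 0 := by
    intro c
    rw [integral_indicator measurableSet_Icc, setIntegral_const, Measure.real, hvol, smul_eq_mul,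
      mul_comm]
  rw [← hval I, ← integral_sub hint (hconst I), ← Real.norm_eq_abs]
  refine (norm_integral_le_of_norm_le (hconst (K * (2 * ‖z‖))) (ae_of_all _ fun t => ?_)).trans ?_
  · by_cases ht : t ∈ Set.Icc b (b + w)
    · simp only [Set.indicator_of_mem ht]
      exact hGI t ht
    · simp only [Set.indicator_of_notMem ht]
      simp
  · rw [hval]
    have : max w 0 ≤ ‖z‖ := max_le hwz (norm_nonneg z)
    calc K * (2 * ‖z‖) * max w 0 ≤ K * (2 * ‖z‖) * ‖z‖ := by gcongr
      _ = 2 * K * ‖z‖ ^ 2 := by ring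

/-- The bias of the (unrescaled) cut is `O(s²)`, so that of the rescaled cut is `O(s)`. -/
theorem exists_cut_bias_le (hp : GeneralAssumptions p C ν b) :
    ∃ K : ℝ, 0 ≤ K ∧ ∀ s, 0 < s →
      |(∫ z, gaussWeight (k + 1) s ‖z‖ * overlap p (halfPos ν b) (halfNeg ν b) z) -
        s / √(2 * Real.pi) * hyperplaneIntegral ν b fun x => p x ^ 2| ≤ K * s ^ 2 := by
  obtain ⟨K, hK, h⟩ := hp.exists_overlap_half_le
  refine ⟨K * (4 * 2 ^ (((k + 1 : ℕ) : ℝ) / 2)), by positivity, fun s hs => ?_⟩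
  set I := hyperplaneIntegral ν b fun x => p x ^ 2
  have hmax : Integrable fun z : E (k + 1) =>
      gaussWeight (k + 1) s ‖z‖ * max (-inner ℝ ν z) 0 := by
    refine (integrable_gaussWeight_mul_norm (k + 1) hs).mono' ?_ (ae_of_all _ fun z => ?_)
    · exact (((measurable_gaussWeight _ s).comp measurable_norm).mul
        (by fun_prop)).aestronglyMeasurable
    · rw [Real.norm_of_nonneg (mul_nonneg (gaussWeight_nonneg _ _ _) (le_max_right _ _))]
      refine mul_le_mul_of_nonneg_left (max_le ?_ (norm_nonneg z)) (gaussWeight_nonneg _ _ _)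
      have := abs_real_inner_le_norm ν z
      rw [hp.norm_normal, one_mul] at this
      linarith [neg_le_of_abs_le this]
  rw [← integral_gaussWeight_mul_max hp.norm_normal hs, ← integral_mul_const,
    ← integral_sub (hp.integrable_gaussWeight_mul_overlap hs (measurableSet_halfPos ν b)
      (measurableSet_halfNeg ν b)) (hmax.mul_const I), ← Real.norm_eq_abs]
  refine (norm_integral_le_of_norm_le ((integrable_gaussWeight_mul_sq (k + 1) hs).const_mul K)
    (ae_of_all _ fun z => ?_)).trans ?_
  · rw [mul_assoc, ← mul_sub, norm_mul, Real.norm_of_nonneg (gaussWeight_nonneg _ _ _),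
      Real.norm_eq_abs, mul_comm (max _ _) I]
    calc _ ≤ gaussWeight (k + 1) s ‖z‖ * (K * ‖z‖ ^ 2) :=
          mul_le_mul_of_nonneg_left (h z) (gaussWeight_nonneg _ _ _)
      _ = _ := by ring
  · rw [integral_const_mul, mul_assoc K]
    gcongr
    exact integral_gaussWeight_mul_sq_le (k + 1) hs

end GeneralAssumptions

/-! ### Concentration of U-statistics -/

/-- Sum of a kernel over all ordered pairs of distinct indices. -/
noncomputable def offDiagSum {α : Type*} [Fintype α] [DecidableEq α] (H : α → α → ℝ) : ℝ :=
  ∑ i, ∑ j, if i = j then 0 else H i j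

theorem exists_perm_apply_eq {α : Type*} [DecidableEq α] {a b i j : α} (hab : a ≠ b) (hij : i ≠ j) :
    ∃ τ : Equiv.Perm α, τ a = i ∧ τ b = j := by
  refine ⟨Equiv.swap (Equiv.swap a i b) j * Equiv.swap a i, ?_, ?_⟩
  · rw [Equiv.Perm.mul_apply, Equiv.swap_apply_left]
    refine Equiv.swap_apply_of_ne_of_ne (fun h => hab ?_) hij
    have := congrArg (Equiv.swap a i) h
    rwa [Equiv.swap_apply_right, Equiv.swap_apply_self] at this
  · rw [Equiv.Perm.mul_apply, Equiv.swap_apply_left]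

/-- Each ordered pair of distinct indices is the image of `(a, b)` under equally many
permutations. -/
theorem sum_perm_eq {α : Type*} [Fintype α] [DecidableEq α] (H : α → α → ℝ) {a b : α}
    (hab : a ≠ b) :
    (Fintype.card α : ℝ) * (Fintype.card α - 1) * ∑ π : Equiv.Perm α, H (π a) (π b) =
      (Fintype.card α).factorial * offDiagSum H := by
  set Q : α → α → ℝ := fun i j => ∑ π : Equiv.Perm α, H (π i) (π j) with hQ
  have hconst : ∀ i j, i ≠ j → Q i j = Q a b := by
    intro i j hij
    obtain ⟨τ, rfl, rfl⟩ := exists_perm_apply_eq hab hij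
    exact Equiv.sum_comp (Equiv.mulRight τ) fun π : Equiv.Perm α => H (π a) (π b)
  have h1 : offDiagSum Q = (Fintype.card α : ℝ) * (Fintype.card α - 1) * Q a b := by
    have : ∀ i : α, (∑ j, if i = j then 0 else Q i j) = ((Fintype.card α : ℝ) - 1) * Q a b := by
      intro i
      have h2 : ∀ j, (if i = j then 0 else Q i j) = Q a b - if i = j then Q a b else 0 := by
        intro j
        split_ifs with h
        · simp
        · rw [hconst i j h, sub_zero]
      simp_rw [h2]
      rw [Finset.sum_sub_distrib, Finset.sum_ite_eq]
      simp
      ring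
    rw [offDiagSum, Finset.sum_congr rfl fun i _ => this i]
    simp
    ring
  have h2 : offDiagSum Q = (Fintype.card α).factorial * offDiagSum H := by
    have h3 : ∀ π : Equiv.Perm α, offDiagSum (fun i j => H (π i) (π j)) = offDiagSum H := by
      intro π
      calc offDiagSum (fun i j => H (π i) (π j))
          = ∑ i, ∑ j, if π i = π j then 0 else H (π i) (π j) := by
            simp only [offDiagSum, π.injective.eq_iff]
        _ = ∑ i, ∑ j, if π i = j then 0 else H (π i) j := Finset.sum_congr rfl fun i _ =>
            Equiv.sum_comp π fun j => if π i = j then 0 else H (π i) j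
        _ = offDiagSum H := Equiv.sum_comp π fun i => ∑ j, if i = j then 0 else H i j
    calc offDiagSum Q = ∑ π : Equiv.Perm α, offDiagSum (fun i j => H (π i) (π j)) := by
          simp only [offDiagSum, hQ]
          rw [eq_comm, Finset.sum_comm]
          refine Finset.sum_congr rfl fun i _ => ?_
          rw [Finset.sum_comm]
          refine Finset.sum_congr rfl fun j _ => ?_
          split_ifs <;> simp
      _ = _ := by
          rw [Finset.sum_congr rfl fun π _ => h3 π]
          simp [Fintype.card_perm]
  rw [← h1, h2]

section Probability

variable {Ω S : Type*} [MeasurableSpace Ω] [MeasurableSpace S] {P : Measure Ω}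
  [IsProbabilityMeasure P]

/-- Bennett-type bound for the moment generating function of a variable with values in
`[0, M]`. -/
theorem mgf_le_of_mem_Icc {Y : Ω → ℝ} (hY : Measurable Y) {M θ l : ℝ} (h0 : ∀ ω, 0 ≤ Y ω)
    (hM : ∀ ω, Y ω ≤ M) (hθ : ∫ ω, Y ω ∂P = θ) (hl : |l| * M ≤ 1) :
    mgf Y P l ≤ Real.exp (l * θ + l ^ 2 * (M * θ)) := by
  have hM0 : 0 ≤ M := by
    obtain ⟨ω⟩ : Nonempty Ω := nonempty_of_isProbabilityMeasure P
    exact (h0 ω).trans (hM ω)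
  have hYi : Integrable Y P := (integrable_const M).mono' hY.aestronglyMeasurable
    (ae_of_all _ fun ω => by rw [Real.norm_of_nonneg (h0 ω)]; exact hM ω)
  have hθ0 : 0 ≤ θ := hθ ▸ integral_nonneg h0
  have hθM : θ ≤ M := by
    rw [← hθ]
    exact (integral_mono hYi (integrable_const M) hM).trans (by simp)
  have hpt : ∀ ω, Real.exp (l * Y ω) ≤
      Real.exp (l * θ) * (1 + l * (Y ω - θ) + l ^ 2 * (M * Y ω - 2 * θ * Y ω + θ ^ 2)) := by
    intro ω
    have h1 : |l * (Y ω - θ)| ≤ 1 := by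
      rw [abs_mul]
      refine (mul_le_mul_of_nonneg_left ?_ (abs_nonneg l)).trans hl
      rw [abs_le]
      constructor <;> linarith [h0 ω, hM ω]
    have h2 := le_of_abs_le (Real.abs_exp_sub_one_sub_id_le h1)
    have h3 : l * Y ω = l * θ + l * (Y ω - θ) := by ring
    rw [h3, Real.exp_add]
    refine mul_le_mul_of_nonneg_left ?_ (Real.exp_pos _).le
    have h4 : l ^ 2 * (Y ω * Y ω) ≤ l ^ 2 * (M * Y ω) := by
      gcongr
      · exact h0 ω
      · exact hM ω
    nlinarith
  have i0 : Integrable (fun ω => l * (Y ω - θ)) P := (hYi.sub (integrable_const _)).const_mul _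
  have i1 : Integrable (fun ω => 1 + l * (Y ω - θ)) P := (integrable_const _).add i0
  have i3 : Integrable (fun ω => M * Y ω - 2 * θ * Y ω) P :=
    (hYi.const_mul _).sub (hYi.const_mul _)
  have i2 : Integrable (fun ω => M * Y ω - 2 * θ * Y ω + θ ^ 2) P := i3.add (integrable_const _)
  calc mgf Y P l ≤ ∫ ω, Real.exp (l * θ) *
        (1 + l * (Y ω - θ) + l ^ 2 * (M * Y ω - 2 * θ * Y ω + θ ^ 2)) ∂P :=
        integral_mono_of_nonneg (ae_of_all _ fun ω => (Real.exp_pos _).le)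
          ((i1.add (i2.const_mul _)).const_mul _) (ae_of_all _ hpt)
    _ = Real.exp (l * θ) * (1 + l ^ 2 * (M * θ - θ ^ 2)) := by
        rw [integral_const_mul, integral_add i1 (i2.const_mul _), integral_const_mul,
          integral_add (integrable_const _) i0,
          integral_const_mul, integral_sub hYi (integrable_const _),
          integral_add i3 (integrable_const _),
          integral_sub (hYi.const_mul _) (hYi.const_mul _), integral_const_mul,
          integral_const_mul, hθ]
        simp only [integral_const, probReal_univ, smul_eq_mul]
        ring
    _ ≤ Real.exp (l * θ) * Real.exp (l ^ 2 * (M * θ)) := by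
        gcongr
        have := Real.add_one_le_exp (l ^ 2 * (M * θ))
        nlinarith [mul_nonneg (sq_nonneg l) (sq_nonneg θ)]
    _ = _ := by rw [← Real.exp_add]

variable {X : ℕ → Ω → S} {μ : Measure S}

theorem integral_pair (hX : ∀ i, Measurable (X i)) (hlaw : ∀ i, P.map (X i) = μ)
    (hind : iIndepFun X P) {h : S → S → ℝ} (hh : Measurable fun q : S × S => h q.1 q.2)
    {a b : ℕ} (hab : a ≠ b) :
    ∫ ω, h (X a ω) (X b ω) ∂P = ∫ q, h q.1 q.2 ∂(μ.prod μ) := by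
  have h1 := (indepFun_iff_map_prod_eq_prod_map_map (hX a).aemeasurable (hX b).aemeasurable).mp
    (hind.indepFun hab)
  rw [hlaw, hlaw] at h1
  rw [← h1, integral_map ((hX a).prodMk (hX b)).aemeasurable hh.aestronglyMeasurable]

/-- The moment generating function of a sum over disjoint pairs of sample points factorizes. -/
theorem mgf_sum_pairs (hX : ∀ i, Measurable (X i)) (hind : iIndepFun X P) {h : S → S → ℝ}
    (hh : Measurable fun q : S × S => h q.1 q.2) {ι : Type*} [DecidableEq ι] {a b : ι → ℕ}
    (ha : a.Injective) (hb : b.Injective) (hab : ∀ i j, a i ≠ b j) (l : ℝ) (s : Finset ι) :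
    mgf (fun ω => ∑ i ∈ s, h (X (a i) ω) (X (b i) ω)) P l =
      ∏ i ∈ s, mgf (fun ω => h (X (a i) ω) (X (b i) ω)) P l := by
  have hm : ∀ i, Measurable fun ω => h (X (a i) ω) (X (b i) ω) := fun i =>
    hh.comp ((hX _).prodMk (hX _))
  induction s using Finset.induction_on with
  | empty => simp
  | insert j s hj ih =>
    have hdisj : Disjoint ({a j, b j} : Finset ℕ) (s.image a ∪ s.image b) := by
      rw [Finset.disjoint_left]
      intro x hx hx'
      simp only [Finset.mem_insert, Finset.mem_singleton] at hx
      simp only [Finset.mem_union, Finset.mem_image] at hx'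
      rcases hx with rfl | rfl <;> rcases hx' with ⟨i, hi, h'⟩ | ⟨i, hi, h'⟩
      · exact hj (ha h' ▸ hi)
      · exact hab _ _ h'.symm
      · exact hab _ _ h'
      · exact hj (hb h' ▸ hi)
    have hI := hind.indepFun_finset _ _ hdisj hX
    have hI' : IndepFun (fun ω => h (X (a j) ω) (X (b j) ω))
        (fun ω => ∑ i ∈ s, h (X (a i) ω) (X (b i) ω)) P := by
      let φ : (({a j, b j} : Finset ℕ) → S) → ℝ := fun x =>
        h (x ⟨a j, by simp⟩) (x ⟨b j, by simp⟩)
      let ψ : ((s.image a ∪ s.image b : Finset ℕ) → S) → ℝ := fun x =>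
        ∑ i ∈ s.attach, h
          (x ⟨a i, Finset.mem_union_left _ (Finset.mem_image_of_mem _ i.2)⟩)
          (x ⟨b i, Finset.mem_union_right _ (Finset.mem_image_of_mem _ i.2)⟩)
      have hcoord : ∀ (T : Finset ℕ) (i j : T), Measurable fun x : T → S => h (x i) (x j) :=
        fun T i j => Measurable.comp (f := fun x : T → S => (x i, x j)) hh (by fun_prop)
      have hφ : Measurable φ := hcoord _ _ _
      have hψ : Measurable ψ := Finset.measurable_sum _ fun i _ => hcoord _ _ _
      exact (hI.comp hφ hψ).congr (ae_of_all _ fun _ => rfl) (ae_of_all _ fun ω =>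
        Finset.sum_attach s fun i => h (X (a i) ω) (X (b i) ω))
    rw [Finset.prod_insert hj, ← ih, ← hI'.mgf_add]
    · congr 1
      funext ω
      rw [Finset.sum_insert hj]
      rfl
    · exact ((hm j).const_mul l).exp.aestronglyMeasurable
    · exact ((Finset.measurable_sum s fun i _ => hm i).const_mul l).exp.aestronglyMeasurable

/-- Exponential moment bound for a U-statistic: it is an average, over permutations, of means of
`n / 2` independent variables, so Jensen's inequality reduces to the independent case. -/
theorem mgf_offDiagSum_le (hX : ∀ i, Measurable (X i)) (hlaw : ∀ i, P.map (X i) = μ)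
    (hind : iIndepFun X P) {h : S → S → ℝ} (hh : Measurable fun q : S × S => h q.1 q.2)
    {M : ℝ} (h0 : ∀ x y, 0 ≤ h x y) (hM : ∀ x y, h x y ≤ M) {n : ℕ} (hn : 2 ≤ n) {l : ℝ}
    (hl : |l| * M ≤ 1) :
    mgf (fun ω => (n / 2 : ℕ) * (offDiagSum (fun i j : Fin n => h (X i ω) (X j ω)) /
        (n * (n - 1)) - ∫ q, h q.1 q.2 ∂(μ.prod μ))) P l ≤
      Real.exp ((n / 2 : ℕ) * (l ^ 2 * (M * ∫ q, h q.1 q.2 ∂(μ.prod μ)))) := by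
  set m := n / 2 with hm
  have hmpos : 0 < m := by omega
  set θ := ∫ q, h q.1 q.2 ∂(μ.prod μ) with hθ
  let a : Fin m → Fin n := fun i => ⟨2 * i, by omega⟩
  let b : Fin m → Fin n := fun i => ⟨2 * i + 1, by omega⟩
  have ha : a.Injective := fun i j hij => by
    have := congrArg Fin.val hij
    simp only [a] at this
    ext; omega
  have hb : b.Injective := fun i j hij => by
    have := congrArg Fin.val hij
    simp only [b] at this
    ext; omega
  have hab : ∀ i j, a i ≠ b j := fun i j hij => by
    have := congrArg Fin.val hij
    simp only [a, b] at this
    omega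
  have hn1 : (0 : ℝ) < n * (n - 1) := by
    have : (2 : ℝ) ≤ n := by exact_mod_cast hn
    nlinarith
  have hfac : (0 : ℝ) < n.factorial := by exact_mod_cast n.factorial_pos
  let Z : Equiv.Perm (Fin n) → Ω → ℝ := fun π ω =>
    ∑ i, h (X (π (a i)) ω) (X (π (b i)) ω)
  have hZm : ∀ π, Measurable (Z π) := fun π => Finset.measurable_sum _ fun i _ =>
    hh.comp ((hX _).prodMk (hX _))
  have hZ0 : ∀ π ω, 0 ≤ Z π ω := fun π ω => Finset.sum_nonneg fun i _ => h0 _ _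
  have hZM : ∀ π ω, Z π ω ≤ m * M := fun π ω =>
    (Finset.sum_le_sum fun i _ => hM _ _).trans (by simp)
  have hexpi : ∀ π, Integrable (fun ω => Real.exp (l * (Z π ω - m * θ))) P := by
    intro π
    refine (integrable_const (Real.exp (|l| * (m * M + |m * θ|)))).mono'
      (((hZm π).sub_const _).const_mul l).exp.aestronglyMeasurable (ae_of_all _ fun ω => ?_)
    rw [Real.norm_of_nonneg (Real.exp_pos _).le, Real.exp_le_exp]
    refine (le_abs_self _).trans ?_
    rw [abs_mul]
    refine mul_le_mul_of_nonneg_left ((abs_sub _ _).trans ?_) (abs_nonneg l)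
    rw [abs_of_nonneg (hZ0 π ω)]
    linarith [hZM π ω]
  have hZmgf : ∀ π, ∫ ω, Real.exp (l * (Z π ω - m * θ)) ∂P ≤ Real.exp (m * (l ^ 2 * (M * θ))) := by
    intro π
    have hinj : Function.Injective fun i : Fin n => ((π i : Fin n) : ℕ) :=
      Fin.val_injective.comp π.injective
    have h1 := mgf_sum_pairs hX hind hh (a := fun i => ((π (a i) : Fin n) : ℕ))
      (b := fun i => ((π (b i) : Fin n) : ℕ)) (hinj.comp ha) (hinj.comp hb)
      (fun i j hij => hab i j (hinj hij)) l Finset.univ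
    have h2 : mgf (Z π) P l ≤ ∏ _i : Fin m, Real.exp (l * θ + l ^ 2 * (M * θ)) := by
      refine (le_of_eq h1).trans (Finset.prod_le_prod (fun i _ => mgf_nonneg) fun i _ => ?_)
      exact mgf_le_of_mem_Icc (hh.comp ((hX _).prodMk (hX _))) (fun ω => h0 _ _) (fun ω => hM _ _)
        (integral_pair hX hlaw hind hh fun hij => hab i i (hinj hij)) hl
    rw [Finset.prod_const, Finset.card_univ, Fintype.card_fin, ← Real.exp_nat_mul] at h2
    calc ∫ ω, Real.exp (l * (Z π ω - m * θ)) ∂P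
        = ∫ ω, Real.exp (-(l * (m * θ))) * Real.exp (l * Z π ω) ∂P := by
          congr 1
          funext ω
          rw [← Real.exp_add]
          congr 1; ring
      _ = Real.exp (-(l * (m * θ))) * mgf (Z π) P l := by rw [integral_const_mul]; rfl
      _ ≤ Real.exp (-(l * (m * θ))) * Real.exp (m * (l * θ + l ^ 2 * (M * θ))) := by gcongr
      _ = Real.exp (m * (l ^ 2 * (M * θ))) := by
          rw [← Real.exp_add]
          congr 1; ring
  have hw : ∑ _π : Equiv.Perm (Fin n), (1 / n.factorial : ℝ) = 1 := by
    rw [Finset.sum_const, Finset.card_univ, Fintype.card_perm, Fintype.card_fin, nsmul_eq_mul]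
    field_simp
  have hrepr : ∀ ω, l * (m * (offDiagSum (fun i j : Fin n => h (X i ω) (X j ω)) /
      (n * (n - 1)) - θ)) =
        ∑ π : Equiv.Perm (Fin n), (1 / n.factorial : ℝ) • (l * (Z π ω - m * θ)) := by
    intro ω
    have h1 : ∑ π : Equiv.Perm (Fin n), Z π ω =
        m * (n.factorial *
          (offDiagSum (fun i j : Fin n => h (X i ω) (X j ω)) / (n * (n - 1)))) := by
      have h2 : ∀ i : Fin m, ∑ π : Equiv.Perm (Fin n), h (X (π (a i)) ω) (X (π (b i)) ω) =
          n.factorial * (offDiagSum (fun i j : Fin n => h (X i ω) (X j ω)) / (n * (n - 1))) := by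
        intro i
        have := sum_perm_eq (fun i j : Fin n => h (X i ω) (X j ω)) (hab i i)
        rw [Fintype.card_fin] at this
        rw [← mul_div_assoc, ← this, mul_div_cancel_left₀ _ hn1.ne']
      simp only [Z]
      rw [Finset.sum_comm, Finset.sum_congr rfl fun i _ => h2 i]
      simp
    simp only [smul_eq_mul]
    rw [← Finset.mul_sum, ← Finset.mul_sum, Finset.sum_sub_distrib, h1, Finset.sum_const,
      Finset.card_univ, Fintype.card_perm, Fintype.card_fin, nsmul_eq_mul]
    field_simp
  calc mgf _ P l ≤ ∫ ω, ∑ π : Equiv.Perm (Fin n),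
        (1 / n.factorial : ℝ) * Real.exp (l * (Z π ω - m * θ)) ∂P := by
        refine integral_mono_of_nonneg (ae_of_all _ fun ω => (Real.exp_pos _).le)
          (integrable_finsetSum _ fun π _ => (hexpi π).const_mul _) (ae_of_all _ fun ω => ?_)
        simp only
        rw [hrepr ω]
        exact convexOn_exp.map_sum_le (fun _ _ => by positivity) hw fun _ _ => Set.mem_univ _
    _ = ∑ π : Equiv.Perm (Fin n),
        (1 / n.factorial : ℝ) * ∫ ω, Real.exp (l * (Z π ω - m * θ)) ∂P := by
        rw [integral_finsetSum _ fun π _ => (hexpi π).const_mul _]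
        exact Finset.sum_congr rfl fun π _ => integral_const_mul _ _
    _ ≤ ∑ π : Equiv.Perm (Fin n), (1 / n.factorial : ℝ) * Real.exp (m * (l ^ 2 * (M * θ))) := by
        refine Finset.sum_le_sum fun π _ => ?_
        exact mul_le_mul_of_nonneg_left (hZmgf π) (by positivity)
    _ = Real.exp (m * (l ^ 2 * (M * θ))) := by
        rw [← Finset.sum_mul, hw, one_mul]

theorem measurable_offDiagSum (hX : ∀ i, Measurable (X i)) {h : S → S → ℝ}
    (hh : Measurable fun q : S × S => h q.1 q.2) (n : ℕ) :
    Measurable fun ω => offDiagSum fun i j : Fin n => h (X i ω) (X j ω) := by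
  unfold offDiagSum
  refine Finset.measurable_sum _ fun i _ => Finset.measurable_sum _ fun j _ => ?_
  split_ifs
  · exact measurable_const
  · exact hh.comp ((hX _).prodMk (hX _))

/-- Bernstein-type tail bound for a U-statistic with a bounded nonnegative kernel. -/
theorem measureReal_abs_offDiagSum_sub_ge_le (hX : ∀ i, Measurable (X i))
    (hlaw : ∀ i, P.map (X i) = μ) (hind : iIndepFun X P) {h : S → S → ℝ}
    (hh : Measurable fun q : S × S => h q.1 q.2) {M : ℝ} (h0 : ∀ x y, 0 ≤ h x y)
    (hM : ∀ x y, h x y ≤ M) {n : ℕ} (hn : 2 ≤ n) {l t : ℝ} (hl0 : 0 ≤ l) (hl : l * M ≤ 1) :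
    P.real {ω | t ≤ |offDiagSum (fun i j : Fin n => h (X i ω) (X j ω)) / (n * (n - 1)) -
        ∫ q, h q.1 q.2 ∂(μ.prod μ)|} ≤
      2 * Real.exp ((n / 2 : ℕ) * (l ^ 2 * (M * ∫ q, h q.1 q.2 ∂(μ.prod μ)) - l * t)) := by
  set m := n / 2 with hm
  have hmpos : (0 : ℝ) < m := by exact_mod_cast (by omega : 0 < m)
  set θ := ∫ q, h q.1 q.2 ∂(μ.prod μ) with hθ
  set W : Ω → ℝ := fun ω => m * (offDiagSum (fun i j : Fin n => h (X i ω) (X j ω)) /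
    (n * (n - 1)) - θ) with hW
  have hn1 : (0 : ℝ) < n * (n - 1) := by
    have : (2 : ℝ) ≤ n := by exact_mod_cast hn
    nlinarith
  have hWm : Measurable W := (((measurable_offDiagSum hX hh n).div_const _).sub_const _).const_mul _
  have hUb : ∀ ω, |W ω| ≤ m * ((n * n * |M|) / (n * (n - 1)) + |θ|) := by
    intro ω
    rw [hW]
    simp only
    rw [abs_mul, abs_of_pos hmpos]
    refine mul_le_mul_of_nonneg_left ((abs_sub _ _).trans ?_) hmpos.le
    refine add_le_add_left ?_ _
    rw [abs_div, abs_of_pos hn1]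
    refine div_le_div_of_nonneg_right ?_ hn1.le
    unfold offDiagSum
    refine (Finset.abs_sum_le_sum_abs _ _).trans ?_
    calc _ ≤ ∑ _i : Fin n, ∑ _j : Fin n, |M| := by
          refine Finset.sum_le_sum fun i _ => (Finset.abs_sum_le_sum_abs _ _).trans
            (Finset.sum_le_sum fun j _ => ?_)
          split_ifs
          · simp
          · rw [abs_of_nonneg (h0 _ _)]
            exact (hM _ _).trans (le_abs_self _)
      _ = n * n * |M| := by simp; ring
  have hexp : ∀ c : ℝ, Integrable (fun ω => Real.exp (c * W ω)) P := by
    intro c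
    refine (integrable_const (Real.exp (|c| * (m * ((n * n * |M|) / (n * (n - 1)) + |θ|))))).mono'
      (hWm.const_mul c).exp.aestronglyMeasurable (ae_of_all _ fun ω => ?_)
    rw [Real.norm_of_nonneg (Real.exp_pos _).le, Real.exp_le_exp]
    refine (le_abs_self _).trans ?_
    rw [abs_mul]
    exact mul_le_mul_of_nonneg_left (hUb ω) (abs_nonneg c)
  have hup : P.real {ω | m * t ≤ W ω} ≤ Real.exp (m * (l ^ 2 * (M * θ) - l * t)) := by
    refine (measure_ge_le_exp_mul_mgf (m * t) hl0 (hexp l)).trans ?_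
    refine (mul_le_mul_of_nonneg_left (mgf_offDiagSum_le hX hlaw hind hh h0 hM hn
      (by rwa [abs_of_nonneg hl0])) (Real.exp_pos _).le).trans (le_of_eq ?_)
    rw [← Real.exp_add]
    congr 1
    ring
  have hlow : P.real {ω | W ω ≤ -(m * t)} ≤ Real.exp (m * (l ^ 2 * (M * θ) - l * t)) := by
    refine (measure_le_le_exp_mul_mgf (-(m * t)) (neg_nonpos.mpr hl0) (hexp (-l))).trans ?_
    refine (mul_le_mul_of_nonneg_left (mgf_offDiagSum_le hX hlaw hind hh h0 hM hn
      (by rwa [abs_neg, abs_of_nonneg hl0])) (Real.exp_pos _).le).trans (le_of_eq ?_)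
    rw [← Real.exp_add]
    congr 1
    ring
  have hsub : {ω | t ≤ |offDiagSum (fun i j : Fin n => h (X i ω) (X j ω)) / (n * (n - 1)) - θ|} ⊆
      {ω | m * t ≤ W ω} ∪ {ω | W ω ≤ -(m * t)} := by
    intro ω hω
    rw [Set.mem_ofPred_eq, le_abs] at hω
    rcases hω with hω | hω
    · exact Or.inl (mul_le_mul_of_nonneg_left hω hmpos.le)
    · refine Or.inr ?_
      have := mul_le_mul_of_nonneg_left hω hmpos.le
      change m * _ ≤ -(m * t)
      linarith
  calc _ ≤ P.real ({ω | m * t ≤ W ω} ∪ {ω | W ω ≤ -(m * t)}) := measureReal_mono hsub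
    _ ≤ P.real {ω | m * t ≤ W ω} + P.real {ω | W ω ≤ -(m * t)} := measureReal_union_le _ _
    _ ≤ _ := by linarith

/-- Almost sure deviation bound for U-statistics with varying kernels `0 ≤ h_n ≤ M_n` of bounded
mean. The variance proxy `M_n E h_n` makes the deviation of order `√(M_n log n / n)`. -/
theorem ae_eventually_abs_offDiagSum_sub_le (hX : ∀ i, Measurable (X i))
    (hlaw : ∀ i, P.map (X i) = μ) (hind : iIndepFun X P) {h : ℕ → S → S → ℝ}
    (hh : ∀ n, Measurable fun q : S × S => h n q.1 q.2) {M : ℕ → ℝ} {θ₀ : ℝ} (hθ₀ : 0 ≤ θ₀)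
    (hbound : ∀ᶠ n in atTop, 0 < M n ∧ (∀ x y, 0 ≤ h n x y) ∧ (∀ x y, h n x y ≤ M n) ∧
      ∫ q, h n q.1 q.2 ∂(μ.prod μ) ≤ θ₀)
    (hlim : Tendsto (fun n : ℕ => M n * Real.log n / n) atTop (𝓝 0)) :
    ∀ᵐ ω ∂P, ∀ᶠ n : ℕ in atTop,
      |offDiagSum (fun i j : Fin n => h n (X i ω) (X j ω)) / (n * (n - 1)) -
        ∫ q, h n q.1 q.2 ∂(μ.prod μ)| ≤ 3 * (θ₀ + 2) * √(M n * Real.log n / n) := by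
  set s : ℕ → Set Ω := fun n => {ω | 3 * (θ₀ + 2) * √(M n * Real.log n / n) ≤
    |offDiagSum (fun i j : Fin n => h n (X i ω) (X j ω)) / (n * (n - 1)) -
      ∫ q, h n q.1 q.2 ∂(μ.prod μ)|} with hs
  have hprob : ∀ᶠ n : ℕ in atTop, P (s n) ≤ ENNReal.ofReal (2 * (1 / (n : ℝ) ^ 2)) := by
    filter_upwards [hbound, hlim.eventually_le_const one_pos, eventually_ge_atTop 2]
      with n ⟨hM0, h0, hM, hθ⟩ hsmall hn
    have hn2 : (2 : ℝ) ≤ n := by exact_mod_cast hn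
    have hnpos : (0 : ℝ) < n := by linarith
    have hlog : 0 ≤ Real.log n := Real.log_nonneg (by linarith)
    set ε := √(M n * Real.log n / n) with hε
    have hε0 : 0 ≤ ε := Real.sqrt_nonneg _
    have hε1 : ε ≤ 1 := Real.sqrt_le_one.mpr hsmall
    have hεsq : ε ^ 2 = M n * Real.log n / n := Real.sq_sqrt (by positivity)
    -- this exponent balances the two terms of the tail bound, which then is at most `2 / n ^ 2`
    have := measureReal_abs_offDiagSum_sub_ge_le hX hlaw hind (hh n) h0 hM hn
      (l := ε / M n) (t := 3 * (θ₀ + 2) * ε) (by positivity) (by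
        rwa [div_mul_cancel₀ _ hM0.ne'])
    rw [← ofReal_measureReal]
    refine ENNReal.ofReal_le_ofReal (this.trans ?_)
    refine mul_le_mul_of_nonneg_left ?_ (by norm_num)
    set θ := ∫ q, h n q.1 q.2 ∂(μ.prod μ)
    have hm3 : (n : ℝ) / 3 ≤ (n / 2 : ℕ) := by
      have : n ≤ 3 * (n / 2) := by omega
      have : (n : ℝ) ≤ 3 * (n / 2 : ℕ) := by exact_mod_cast this
      linarith
    have hexp : ((n / 2 : ℕ) : ℝ) * ((ε / M n) ^ 2 * (M n * θ) - ε / M n * (3 * (θ₀ + 2) * ε)) ≤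
        -(2 * Real.log n) := by
      have e1 : (ε / M n) ^ 2 * (M n * θ) - ε / M n * (3 * (θ₀ + 2) * ε) =
          Real.log n / n * (θ - 3 * (θ₀ + 2)) := by
        calc _ = ε ^ 2 / M n * (θ - 3 * (θ₀ + 2)) := by field_simp
          _ = _ := by rw [hεsq]; field_simp
      rw [e1]
      have h6 : θ - 3 * (θ₀ + 2) ≤ -6 := by linarith
      have h7 : Real.log n / 3 ≤ (n / 2 : ℕ) * (Real.log n / n) := by
        calc Real.log n / 3 = (n : ℝ) / 3 * (Real.log n / n) := by field_simp
          _ ≤ _ := by gcongr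
      calc ((n / 2 : ℕ) : ℝ) * (Real.log n / n * (θ - 3 * (θ₀ + 2)))
          = ((n / 2 : ℕ) * (Real.log n / n)) * (θ - 3 * (θ₀ + 2)) := by ring
        _ ≤ ((n / 2 : ℕ) * (Real.log n / n)) * (-6) := by gcongr
        _ ≤ -(2 * Real.log n) := by linarith
    calc _ ≤ Real.exp (-(2 * Real.log n)) := Real.exp_le_exp.mpr hexp
      _ = 1 / (n : ℝ) ^ 2 := by
        rw [Real.exp_neg, two_mul, Real.exp_add, Real.exp_log hnpos, one_div, pow_two]
  obtain ⟨N, hN⟩ := eventually_atTop.mp hprob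
  have hsum : Summable fun n : ℕ => 2 * (1 / ((n + N : ℕ) : ℝ) ^ 2) :=
    (((summable_nat_add_iff N).mpr
      (Real.summable_one_div_nat_pow.mpr (by norm_num : 1 < 2))).mul_left 2)
  have hfin : ∑' n, P (s (n + N)) ≠ ⊤ :=
    ne_top_of_le_ne_top hsum.tsum_ofReal_ne_top
      (ENNReal.tsum_le_tsum fun n => hN (n + N) (Nat.le_add_left N n))
  filter_upwards [ae_eventually_notMem hfin] with ω hω
  have : ∀ᶠ n in atTop, ω ∉ s n := by
    rw [← map_add_atTop_eq_nat N]
    exact hω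
  filter_upwards [this] with n hn
  exact (not_le.mp hn).le

end Probability

/-! ### From U-statistics to the normalized and Cheeger cuts -/

section Sample

variable {d n : ℕ}

theorem vol_completeWeight (s : ℝ) (x : Fin n → E d) (H : Set (E d)) :
    vol (completeWeight s x) (pointsIn x H) =
      offDiagSum fun i j => pairKernel s H Set.univ (x i) (x j) := by
  classical
  unfold vol pointsIn offDiagSum
  rw [Finset.sum_filter]
  refine Finset.sum_congr rfl fun i _ => ?_
  by_cases hi : x i ∈ H
  · rw [if_pos hi]
    refine Finset.sum_congr rfl fun j _ => ?_
    by_cases hij : i = j <;> simp [completeWeight, pairKernel, hij, hi]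
  · rw [if_neg hi]
    exact (Finset.sum_eq_zero fun j _ => by simp [pairKernel, hi]).symm

theorem cut_completeWeight (s : ℝ) (x : Fin n → E d) (A B : Set (E d)) :
    cut (completeWeight s x) (pointsIn x A) (pointsIn x B) =
      2 * offDiagSum fun i j => pairKernel s A B (x i) (x j) := by
  classical
  unfold cut pointsIn offDiagSum
  rw [Finset.sum_filter, Finset.mul_sum]
  refine Finset.sum_congr rfl fun i _ => ?_
  rw [Finset.mul_sum]
  by_cases hi : x i ∈ A
  · rw [if_pos hi, Finset.sum_filter]
    refine Finset.sum_congr rfl fun j _ => ?_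
    by_cases hj : x j ∈ B
    · by_cases hij : i = j
      · simp [completeWeight, hij]
      · have hji : j ≠ i := fun h => hij h.symm
        simp [completeWeight, pairKernel, hij, hji, hi, hj, dist_comm (x j) (x i)]
        ring
    · simp [pairKernel, hj]
  · rw [if_neg hi]
    exact (Finset.sum_eq_zero fun j _ => by simp [pairKernel, hi]).symm

theorem offDiagSum_const_mul {α : Type*} [Fintype α] [DecidableEq α] (c : ℝ) (H : α → α → ℝ) :
    (offDiagSum fun i j => c * H i j) = c * offDiagSum H := by
  unfold offDiagSum
  simp_rw [Finset.mul_sum]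
  refine Finset.sum_congr rfl fun i _ => Finset.sum_congr rfl fun j _ => ?_
  split_ifs <;> simp

end Sample

theorem abs_div_sub_div_le {a a' v v' ε : ℝ} (hv : 0 < v) (ha : |a' - a| ≤ ε)
    (hv' : |v' - v| ≤ ε) (hε : ε ≤ v / 2) :
    |a' / v' - a / v| ≤ 2 * (v + |a|) / v ^ 2 * ε := by
  have h1 : v / 2 ≤ v' := by linarith [neg_le_of_abs_le hv']
  have hv'0 : 0 < v' := by linarith
  have h2 : a' / v' - a / v = ((a' - a) * v - a * (v' - v)) / (v' * v) := by
    field_simp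
    ring
  have hε0 : 0 ≤ ε := (abs_nonneg _).trans ha
  have h3 : |(a' - a) * v - a * (v' - v)| ≤ ε * v + |a| * ε := by
    refine (abs_sub _ _).trans ?_
    rw [abs_mul, abs_mul, abs_of_pos hv]
    gcongr
  rw [h2, abs_div, abs_of_pos (mul_pos hv'0 hv)]
  calc |(a' - a) * v - a * (v' - v)| / (v' * v) ≤ (ε * v + |a| * ε) / (v / 2 * v) := by gcongr
    _ = 2 * (v + |a|) / v ^ 2 * ε := by field_simp

/-- The normalized and the Cheeger cut depend Lipschitz continuously on cut and volumes. -/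
theorem exists_dev_le {d : ℕ} {p : E d → ℝ} {ν : E d} {b : ℝ} (hpos : 0 < volLim p (halfPos ν b))
    (hneg : 0 < volLim p (halfNeg ν b)) :
    ∃ K δ : ℝ, 0 ≤ K ∧ 0 < δ ∧ ∀ (n : ℕ) (s ε : ℝ) (x : Fin n → E d), 0 < n → 0 < s → ε ≤ δ →
      |(offDiagSum fun i j => 2 / s * pairKernel s (halfPos ν b) (halfNeg ν b) (x i) (x j)) / n ^ 2
        - cutLim p ν b| ≤ ε →
      |(offDiagSum fun i j => pairKernel s (halfPos ν b) Set.univ (x i) (x j)) / n ^ 2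
        - volLim p (halfPos ν b)| ≤ ε →
      |(offDiagSum fun i j => pairKernel s (halfNeg ν b) Set.univ (x i) (x j)) / n ^ 2
        - volLim p (halfNeg ν b)| ≤ ε →
      ncutDev p ν b s x ≤ K * ε ∧ cheegerCutDev p ν b s x ≤ K * ε := by
  set v := volLim p (halfPos ν b)
  set w := volLim p (halfNeg ν b)
  set a := cutLim p ν b
  set m := min v w with hm
  have hmpos : 0 < m := lt_min hpos hneg
  refine ⟨2 * (v + |a|) / v ^ 2 + 2 * (w + |a|) / w ^ 2 + 2 * (m + |a|) / m ^ 2, m / 2,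
    by positivity, by positivity, fun n s ε x hn hs hε hA hV hW => ?_⟩
  have hε0 : 0 ≤ ε := (abs_nonneg _).trans hA
  rw [offDiagSum_const_mul] at hA
  have hn0 : (n : ℝ) ≠ 0 := by exact_mod_cast hn.ne'
  have k1 : 0 ≤ 2 * (v + |a|) / v ^ 2 * ε := by positivity
  have k2 : 0 ≤ 2 * (w + |a|) / w ^ 2 * ε := by positivity
  have k3 : 0 ≤ 2 * (m + |a|) / m ^ 2 * ε := by positivity
  have hmv : m ≤ v := min_le_left _ _
  have hmw : m ≤ w := min_le_right _ _
  rw [add_mul, add_mul]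
  constructor
  · unfold ncutDev ncutSample ncut ncutLim sVol sCut
    rw [vol_completeWeight, vol_completeWeight, cut_completeWeight]
    have d1 := abs_div_sub_div_le hpos hA hV (hε.trans (by linarith))
    have d2 := abs_div_sub_div_le hneg hA hW (hε.trans (by linarith))
    generalize (offDiagSum fun i j => pairKernel s (halfPos ν b) (halfNeg ν b) (x i) (x j)) = A at *
    generalize (offDiagSum fun i j => pairKernel s (halfPos ν b) Set.univ (x i) (x j)) = V at *
    generalize (offDiagSum fun i j => pairKernel s (halfNeg ν b) Set.univ (x i) (x j)) = W at *
    have e : (n : ℝ) ^ 2 / (n ^ 2 * s) * (2 * A * (1 / V + 1 / W)) - (a / v + a / w) =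
        (2 / s * A / n ^ 2 / (V / n ^ 2) - a / v) + (2 / s * A / n ^ 2 / (W / n ^ 2) - a / w) := by
      rw [div_div_div_cancel_right₀ (by positivity), div_div_div_cancel_right₀ (by positivity)]
      simp only [div_eq_mul_inv, mul_inv]
      field_simp
      ring
    rw [e]
    exact (abs_add_le _ _).trans (by linarith)
  · unfold cheegerCutDev cheegerCutSample cheegerCut cheegerCutLim sVol sCut
    rw [vol_completeWeight, vol_completeWeight, cut_completeWeight]
    generalize (offDiagSum fun i j => pairKernel s (halfPos ν b) (halfNeg ν b) (x i) (x j)) = A at *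
    generalize (offDiagSum fun i j => pairKernel s (halfPos ν b) Set.univ (x i) (x j)) = V at *
    generalize (offDiagSum fun i j => pairKernel s (halfNeg ν b) Set.univ (x i) (x j)) = W at *
    have hmin : |min (V / (n : ℝ) ^ 2) (W / (n : ℝ) ^ 2) - min v w| ≤ ε :=
      (abs_min_sub_min_le_max _ _ _ _).trans (max_le hV hW)
    have d3 := abs_div_sub_div_le hmpos hA hmin (hε.trans (by linarith))
    rw [min_div_div_right (by positivity), div_div_div_cancel_right₀ (by positivity)] at d3
    have e : (n : ℝ) ^ 2 / (n ^ 2 * s) * (2 * A / min V W) = 2 / s * A / min V W := by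
      field_simp
    rw [e]
    linarith

theorem GeneralAssumptions.volLim_pos {d : ℕ} {p : E d → ℝ} {C : Set (E d)} {ν : E d} {b : ℝ}
    (hp : GeneralAssumptions p C ν b) {H : Set (E d)} (hH : MeasurableSet H)
    (hpos : 0 < densityMeasure p H) : 0 < volLim p H := by
  obtain ⟨M, hM, h0, hle⟩ := hp.exists_bound
  have hint : Integrable fun x => p x ^ 2 := by
    refine (hp.integrable.const_mul M).mono' (hp.measurable.pow_const 2).aestronglyMeasurable
      (ae_of_all _ fun x => ?_)
    rw [Real.norm_of_nonneg (sq_nonneg _), pow_two]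
    exact mul_le_mul_of_nonneg_right (hle x) (h0 x)
  refine (integral_nonneg fun x => sq_nonneg (p x)).lt_of_ne fun h => ?_
  have h1 := (integral_eq_zero_iff_of_nonneg (fun x => sq_nonneg (p x)) hint.integrableOn).mp h.symm
  refine hpos.ne' ?_
  rw [densityMeasure, withDensity_apply _ hH]
  refine (lintegral_congr_ae ?_).trans lintegral_zero
  filter_upwards [h1] with x hx
  have : p x = 0 := by simpa using hx
  simp [this]

section Probability

variable {Ω : Type*} [MeasurableSpace Ω] {P : Measure Ω} [IsProbabilityMeasure P]

/-- Law of large numbers with rate for the U-statistics at hand: bias plus deviation. -/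
theorem exists_ae_eventually_abs_offDiagSum_div_sq_sub_le {d : ℕ} {μ : Measure (E d)}
    {X : ℕ → Ω → E d} (hX : ∀ i, Measurable (X i)) (hlaw : ∀ i, P.map (X i) = μ)
    (hind : iIndepFun X P) {σ : ℕ → ℝ} (hσ : ∀ᶠ n in atTop, 0 < σ n)
    (hσ0 : Tendsto σ atTop (𝓝 0))
    (hσn : Tendsto (fun n : ℕ => (n : ℝ) * σ n ^ (d + 1) / Real.log n) atTop atTop)
    {h : ℕ → E d → E d → ℝ} (hh : ∀ n, Measurable fun q : E d × E d => h n q.1 q.2)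
    (hbound : ∀ᶠ n in atTop, ∀ x y, 0 ≤ h n x y ∧ h n x y ≤ 2 / σ n ^ (d + 1))
    {c : ℝ} {τ : ℕ → ℝ} (hτ : Tendsto τ atTop (𝓝 0))
    (hbias : ∀ᶠ n in atTop, |∫ q, h n q.1 q.2 ∂(μ.prod μ) - c| ≤ τ n) :
    ∃ K : ℝ, 0 ≤ K ∧ ∀ᵐ ω ∂P, ∀ᶠ n : ℕ in atTop,
      |(offDiagSum fun i j : Fin n => h n (X i ω) (X j ω)) / n ^ 2 - c| ≤
        K * (√(Real.log n / (n * σ n ^ (d + 1))) + τ n) := by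
  set r : ℕ → ℝ := fun n => Real.log n / (n * σ n ^ (d + 1)) with hr
  have hr0 : Tendsto r atTop (𝓝 0) := by
    refine (tendsto_inv_atTop_zero.comp hσn).congr fun n => ?_
    simp [hr]
  have hM : ∀ n : ℕ, 2 / σ n ^ (d + 1) * Real.log n / n = 2 * r n := fun n => by
    simp only [hr, div_eq_mul_inv, mul_inv]
    ring
  have hae := ae_eventually_abs_offDiagSum_sub_le hX hlaw hind hh (M := fun n => 2 / σ n ^ (d + 1))
    (θ₀ := |c| + 1) (by positivity) (by
      filter_upwards [hσ, hbound, hbias, hτ.eventually_le_const one_pos] with n h1 h2 h3 h4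
      refine ⟨by positivity, fun x y => (h2 x y).1, fun x y => (h2 x y).2, ?_⟩
      linarith [le_of_abs_le h3, le_abs_self c]) (by
      simp_rw [hM]
      simpa using hr0.const_mul 2)
  simp_rw [hM] at hae
  set B := 3 * (|c| + 1 + 2) * √2 with hB
  have hB0 : 0 ≤ B := by positivity
  refine ⟨2 * B + 2 + |c|, by positivity, ?_⟩
  filter_upwards [hae] with ω hω
  filter_upwards [hω, hbias, hσ, hσ0.eventually_le_const one_pos, eventually_ge_atTop 3]
    with n h1 h2 hs hs1 hn
  have hn3 : (3 : ℝ) ≤ n := by exact_mod_cast hn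
  set U := (offDiagSum fun i j : Fin n => h n (X i ω) (X j ω)) with hU
  set θ := ∫ q, h n q.1 q.2 ∂(μ.prod μ)
  have hτ0 : 0 ≤ τ n := (abs_nonneg _).trans h2
  have hsq : √(2 * r n) = √2 * √(r n) := Real.sqrt_mul (by norm_num) _
  rw [hsq, ← mul_assoc, ← hB] at h1
  have hlog : 1 ≤ Real.log n := by
    rw [Real.le_log_iff_exp_le (by linarith)]
    exact (Real.exp_one_lt_d9.le.trans (by norm_num)).trans hn3
  -- the discrepancy between `n (n - 1)` and `n ^ 2` is absorbed by the deviation term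
  have hinv : 1 / (n : ℝ) ≤ √(r n) := by
    apply Real.le_sqrt_of_sq_le
    have h5 : σ n ^ (d + 1) ≤ 1 := pow_le_one₀ hs.le hs1
    rw [hr]
    calc (1 / (n : ℝ)) ^ 2 = 1 / (n * n) := by rw [div_pow, one_pow, pow_two]
      _ ≤ Real.log n / (n * σ n ^ (d + 1)) := by
          gcongr
          linarith
  have hUn : U / (n : ℝ) ^ 2 = (1 - 1 / n) * (U / (n * (n - 1))) := by
    have : (n : ℝ) - 1 ≠ 0 := by linarith
    field_simp
  set U' := U / ((n : ℝ) * (n - 1))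
  have hU'c : |U' - c| ≤ B * √(r n) + τ n := by
    calc |U' - c| = |(U' - θ) + (θ - c)| := by congr 1; ring
      _ ≤ _ := (abs_add_le _ _).trans (add_le_add h1 h2)
  have hn1 : 1 / (n : ℝ) ≤ 1 := by
    rw [div_le_one (by linarith)]
    linarith
  have hn0 : 0 ≤ 1 / (n : ℝ) := by positivity
  calc |U / (n : ℝ) ^ 2 - c| = |(1 - 1 / n) * (U' - c) - 1 / n * c| := by
        rw [hUn]; congr 1; ring
    _ ≤ |(1 - 1 / n) * (U' - c)| + |1 / n * c| := abs_sub _ _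
    _ = (1 - 1 / n) * |U' - c| + 1 / n * |c| := by
        rw [abs_mul, abs_mul, abs_of_nonneg hn0, abs_of_nonneg (sub_nonneg.mpr hn1)]
    _ ≤ 1 * (B * √(r n) + τ n) + √(r n) * |c| := by
        gcongr
        linarith
    _ ≤ (2 * B + 2 + |c|) * (√(r n) + τ n) := by
        have := Real.sqrt_nonneg (r n)
        nlinarith [mul_nonneg hB0 this, mul_nonneg hB0 hτ0, mul_nonneg (abs_nonneg c) hτ0,
          mul_nonneg (abs_nonneg c) this]

/-- Bias plus deviation bound for both cuts, given a bound `τ` on the bias of the volumes. -/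
theorem exists_ae_eventually_dev_le {k : ℕ} {p : E (k + 1) → ℝ} {C : Set (E (k + 1))}
    {ν : E (k + 1)} {b : ℝ} (hp : GeneralAssumptions p C ν b) {X : ℕ → Ω → E (k + 1)}
    (hXm : ∀ i, AEMeasurable (X i) P) (hXlaw : ∀ i, P.map (X i) = densityMeasure p)
    (hXind : iIndepFun X P) {σ : ℕ → ℝ} (hσ : ∀ᶠ n in atTop, 0 < σ n)
    (hσ0 : Tendsto σ atTop (𝓝 0))
    (hσn : Tendsto (fun n : ℕ => (n : ℝ) * σ n ^ (k + 1 + 1) / Real.log n) atTop atTop)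
    {τ : ℕ → ℝ} (hτ : Tendsto τ atTop (𝓝 0))
    (hbias : ∀ H, MeasurableSet H → (H = halfPos ν b ∨ H = halfNeg ν b) → ∀ᶠ n in atTop,
      |(∫ z, gaussWeight (k + 1) (σ n) ‖z‖ * overlap p H Set.univ z) - volLim p H| ≤ τ n) :
    ∃ K : ℝ, 0 ≤ K ∧ ∀ᵐ ω ∂P, ∀ᶠ n : ℕ in atTop,
      ncutDev p ν b (σ n) (fun i : Fin n => X i ω) ≤
        K * (σ n + √(Real.log n / (n * σ n ^ (k + 1 + 1))) + τ n) ∧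
      cheegerCutDev p ν b (σ n) (fun i : Fin n => X i ω) ≤
        K * (σ n + √(Real.log n / (n * σ n ^ (k + 1 + 1))) + τ n) := by
  have := hp.isProbability
  have hmP := measurableSet_halfPos ν b
  have hmN := measurableSet_halfNeg ν b
  -- measurable modifications of the sample points
  let Y : ℕ → Ω → E (k + 1) := fun i => (hXm i).mk (X i)
  have hY : ∀ i, Measurable (Y i) := fun i => (hXm i).measurable_mk
  have hXY : ∀ i, X i =ᵐ[P] Y i := fun i => (hXm i).ae_eq_mk
  have hYlaw : ∀ i, P.map (Y i) = densityMeasure p := fun i => by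
    rw [← hXlaw i, Measure.map_congr (hXY i)]
  have hYind : iIndepFun Y P := hXind.congr hXY
  obtain ⟨Kc, hKc, hcut⟩ := hp.exists_cut_bias_le
  have hle : ∀ᶠ n in atTop, ∀ (A B : Set (E (k + 1))) x y,
      pairKernel (σ n) A B x y ≤ 1 / σ n ^ (k + 1) := by
    filter_upwards [hσ] with n hs A B x y using pairKernel_le hs A B x y
  -- the cut
  obtain ⟨K₁, hK₁, H₁⟩ := exists_ae_eventually_abs_offDiagSum_div_sq_sub_le hY hYlaw hYind hσ hσ0
    hσn (h := fun n x y => 2 / σ n * pairKernel (σ n) (halfPos ν b) (halfNeg ν b) x y)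
    (fun n => (measurable_pairKernel (σ n) hmP hmN).const_mul _) (by
      filter_upwards [hσ, hle] with n hs hle x y
      refine ⟨mul_nonneg (by positivity) (pairKernel_nonneg _ _ _ _ _), ?_⟩
      calc _ ≤ 2 / σ n * (1 / σ n ^ (k + 1)) := by
            gcongr
            exact hle _ _ _ _
        _ = _ := by rw [pow_succ (σ n) (k + 1)]; field_simp)
    (c := cutLim p ν b) (τ := fun n => 2 * Kc * σ n) (by simpa using hσ0.const_mul (2 * Kc)) (by
      filter_upwards [hσ] with n hs
      rw [integral_const_mul, hp.integral_pairKernel hs hmP hmN]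
      have h1 := hcut (σ n) hs
      have h2 : cutLim p ν b = 2 / σ n * (σ n / √(2 * Real.pi) *
          hyperplaneIntegral ν b fun x => p x ^ 2) := by
        unfold cutLim
        field_simp
      rw [h2, ← mul_sub, abs_mul, abs_of_pos (by positivity)]
      calc _ ≤ 2 / σ n * (Kc * σ n ^ 2) := by gcongr
        _ = _ := by field_simp)
  -- the two volumes
  have hvol : ∀ H, MeasurableSet H → (H = halfPos ν b ∨ H = halfNeg ν b) →
      ∃ K : ℝ, 0 ≤ K ∧ ∀ᵐ ω ∂P, ∀ᶠ n : ℕ in atTop,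
        |(offDiagSum fun i j : Fin n => pairKernel (σ n) H Set.univ (Y i ω) (Y j ω)) / n ^ 2 -
          volLim p H| ≤ K * (√(Real.log n / (n * σ n ^ (k + 1 + 1))) + τ n) := by
    intro H hH hH'
    refine exists_ae_eventually_abs_offDiagSum_div_sq_sub_le hY hYlaw hYind hσ hσ0 hσn
      (h := fun n x y => pairKernel (σ n) H Set.univ x y)
      (fun n => measurable_pairKernel (σ n) hH MeasurableSet.univ) ?_ hτ ?_
    · filter_upwards [hσ, hle, hσ0.eventually_le_const one_pos] with n hs hle hs1 x y
      refine ⟨pairKernel_nonneg _ _ _ _ _, (hle _ _ _ _).trans ?_⟩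
      have : σ n ^ (k + 1 + 1) ≤ σ n ^ (k + 1) := pow_le_pow_of_le_one hs.le hs1 (by omega)
      gcongr
      norm_num
    · filter_upwards [hσ, hbias H hH hH'] with n hs hb
      rwa [hp.integral_pairKernel hs hH MeasurableSet.univ]
  obtain ⟨K₂, hK₂, H₂⟩ := hvol _ hmP (Or.inl rfl)
  obtain ⟨K₃, hK₃, H₃⟩ := hvol _ hmN (Or.inr rfl)
  obtain ⟨K, δ, hK, hδ, hdev⟩ := exists_dev_le (hp.volLim_pos hmP hp.mass_pos)
    (hp.volLim_pos hmN hp.mass_neg)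
  set D := K₁ * (1 + 2 * Kc) + K₂ + K₃ with hD
  have hD0 : 0 ≤ D := by positivity
  have hr0 : Tendsto (fun n : ℕ => √(Real.log n / (n * σ n ^ (k + 1 + 1)))) atTop (𝓝 0) := by
    have : Tendsto (fun n : ℕ => Real.log n / (n * σ n ^ (k + 1 + 1))) atTop (𝓝 0) := by
      refine (tendsto_inv_atTop_zero.comp hσn).congr fun n => ?_
      simp
    have h := (Real.continuous_sqrt.tendsto 0).comp this
    rwa [Real.sqrt_zero] at h
  have hsmall : ∀ᶠ n : ℕ in atTop,
      D * (σ n + √(Real.log n / (n * σ n ^ (k + 1 + 1))) + τ n) ≤ δ := by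
    have : Tendsto (fun n : ℕ => D * (σ n + √(Real.log n / (n * σ n ^ (k + 1 + 1))) + τ n))
        atTop (𝓝 0) := by
      simpa using ((hσ0.add hr0).add hτ).const_mul D
    exact this.eventually_le_const hδ
  refine ⟨K * D, by positivity, ?_⟩
  filter_upwards [H₁, H₂, H₃, ae_all_iff.mpr hXY] with ω h1 h2 h3 hXYω
  filter_upwards [h1, h2, h3, hσ, hsmall, hbias _ hmP (Or.inl rfl), eventually_gt_atTop 0]
    with n h1 h2 h3 hs hsm hb hn
  have hτn : 0 ≤ τ n := (abs_nonneg _).trans hb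
  simp only [hXYω]
  set ρ := √(Real.log n / (n * σ n ^ (k + 1 + 1)))
  have hρ : 0 ≤ ρ := Real.sqrt_nonneg _
  rw [mul_assoc K]
  have hT : 0 ≤ σ n + ρ + τ n := by positivity
  have b1 : K₁ * (ρ + 2 * Kc * σ n) ≤ K₁ * (1 + 2 * Kc) * (σ n + ρ + τ n) := by
    rw [mul_assoc K₁]
    refine mul_le_mul_of_nonneg_left ?_ hK₁
    nlinarith [mul_nonneg hKc hρ, mul_nonneg hKc hτn]
  have b2 : K₂ * (ρ + τ n) ≤ K₂ * (σ n + ρ + τ n) := by gcongr; linarith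
  have b3 : K₃ * (ρ + τ n) ≤ K₃ * (σ n + ρ + τ n) := by gcongr; linarith
  have c1 : 0 ≤ K₁ * (1 + 2 * Kc) * (σ n + ρ + τ n) := by positivity
  have c2 : 0 ≤ K₂ * (σ n + ρ + τ n) := by positivity
  have c3 : 0 ≤ K₃ * (σ n + ρ + τ n) := by positivity
  have hDe : D * (σ n + ρ + τ n) = K₁ * (1 + 2 * Kc) * (σ n + ρ + τ n) +
    K₂ * (σ n + ρ + τ n) + K₃ * (σ n + ρ + τ n) := by rw [hD]; ring
  exact hdev n (σ n) _ _ hn hs hsm (h1.trans (by linarith)) (h2.trans (by linarith))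
    (h3.trans (by linarith))

end Probability

/-! ### Choice of the bandwidth -/

theorem log_div_self_lt_one {n : ℕ} (hn : 2 ≤ n) : Real.log n / n < 1 := by
  have : (0 : ℝ) < n := by exact_mod_cast (by omega : 0 < n)
  rw [div_lt_one this]
  linarith [Real.log_le_sub_one_of_pos this]

/-- No bandwidth makes the bias plus deviation bound smaller than `(log n / n) ^ (1 / (d + 3))`:
at `s = (log n / n) ^ (1 / (d + 3))` the terms `s` and `√(log n / (n s ^ (d + 1)))` agree, and one
of them increases on either side. -/
theorem rpow_le_bias_add_deviation (d : ℕ) {α : ℝ} (hα0 : 0 < α) (hα1 : α < 1) {n : ℕ} (hn : 2 ≤ n)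
    {s : ℝ} (hs : 0 < s) :
    (Real.log n / n) ^ (1 / ((d : ℝ) + 3)) ≤
      s ^ α + √(Real.log n / (n * s ^ (d + 1))) := by
  have hn0 : (0 : ℝ) < n := by exact_mod_cast (by omega : 0 < n)
  have hlog : 0 < Real.log n := Real.log_pos (by exact_mod_cast (by omega : 1 < n))
  rw [← div_div]
  set x := Real.log n / n with hx
  have hx0 : 0 < x := by positivity
  have hx1 : x ≤ 1 := (log_div_self_lt_one hn).le
  set y := x ^ (1 / ((d : ℝ) + 3)) with hy
  have hy0 : 0 < y := by positivity
  have hy1 : y ≤ 1 := Real.rpow_le_one hx0.le hx1 (by positivity)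
  rcases le_or_gt y s with h | h
  · have : y ≤ s ^ α := by
      rcases le_or_gt 1 s with h1 | h1
      · exact hy1.trans (Real.one_le_rpow h1 hα0.le)
      · calc y ≤ s := h
          _ = s ^ (1 : ℝ) := (Real.rpow_one s).symm
          _ ≤ s ^ α := Real.rpow_le_rpow_of_exponent_ge hs h1.le hα1.le
    linarith [Real.sqrt_nonneg (x / s ^ (d + 1))]
  · have hxy : x = y ^ (d + 3) := by
      rw [hy, ← Real.rpow_natCast, ← Real.rpow_mul hx0.le]
      push_cast
      rw [one_div, inv_mul_cancel₀ (by positivity), Real.rpow_one]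
    have : y ≤ √(x / s ^ (d + 1)) := by
      apply Real.le_sqrt_of_sq_le
      rw [le_div_iff₀ (by positivity), hxy]
      calc y ^ 2 * s ^ (d + 1) ≤ y ^ 2 * y ^ (d + 1) := by gcongr
        _ = y ^ (d + 3) := by ring
    linarith [Real.rpow_nonneg hs.le α]

theorem tendsto_log_div_self : Tendsto (fun n : ℕ => Real.log n / n) atTop (𝓝 0) := by
  have h := Real.isLittleO_log_id_atTop.tendsto_div_nhds_zero.comp tendsto_natCast_atTop_atTop
  exact h

/-- For `s = σ₀ (log n / n) ^ (1 / (d + 3))` the squared deviation term is a multiple of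
`(log n / n) ^ (2 / (d + 3))`. -/
theorem log_div_mul_pow_eq (d : ℕ) {σ₀ : ℝ} (hσ₀ : 0 < σ₀) {n : ℕ} (hn : 2 ≤ n) :
    Real.log n / (n * (σ₀ * (Real.log n / n) ^ (1 / ((d : ℝ) + 3))) ^ (d + 1)) =
      (σ₀ ^ (d + 1))⁻¹ * ((Real.log n / n) ^ (1 / ((d : ℝ) + 3))) ^ 2 := by
  have hn0 : (0 : ℝ) < n := by exact_mod_cast (by omega : 0 < n)
  have hlog : 0 < Real.log n := Real.log_pos (by exact_mod_cast (by omega : 1 < n))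
  rw [← div_div]
  set x := Real.log n / n with hx
  have hx0 : 0 < x := by positivity
  set y := x ^ (1 / ((d : ℝ) + 3)) with hy
  have hy0 : 0 < y := by positivity
  have hxy : x = y ^ (d + 3) := by
    rw [hy, ← Real.rpow_natCast, ← Real.rpow_mul hx0.le]
    push_cast
    rw [one_div, inv_mul_cancel₀ (by positivity), Real.rpow_one]
  rw [hxy, mul_pow]
  field_simp
  ring

end NcutLimit

theorem theorem3 {d : ℕ} (hd : 1 ≤ d)
    (p : NcutLimit.E d → ℝ) (C : Set (NcutLimit.E d)) (ν : NcutLimit.E d) (b : ℝ)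
    (hp : NcutLimit.GeneralAssumptions p C ν b)
    {Ω : Type*} [MeasurableSpace Ω] (P : Measure Ω) [IsProbabilityMeasure P]
    (X : ℕ → Ω → NcutLimit.E d)
    (hXm : ∀ i, AEMeasurable (X i) P)
    (hXlaw : ∀ i, P.map (X i) = NcutLimit.densityMeasure p)
    (hXind : iIndepFun X P) :
    -- almost sure convergence of the rescaled Ncut and Cheeger cut
    (∀ σ : ℕ → ℝ, (∀ᶠ n in atTop, 0 < σ n) → Tendsto σ atTop (𝓝 0) →
      Tendsto (fun n : ℕ => (n : ℝ) * σ n ^ (d + 1) / Real.log n) atTop atTop →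
      ∀ᵐ ω ∂P,
        Tendsto (fun n : ℕ => NcutLimit.ncutDev p ν b (σ n) fun i : Fin n => X i ω)
          atTop (𝓝 0) ∧
        Tendsto (fun n : ℕ => NcutLimit.cheegerCutDev p ν b (σ n) fun i : Fin n => X i ω)
          atTop (𝓝 0)) ∧
    -- rates; in dimension one the boundary of the support consists of finitely many points
    ((d = 1 → (frontier C).Finite) → ∀ α : ℝ, 0 < α → α < 1 →
      -- the rate for bandwidths proportional to `(log n / n) ^ (1 / (d + 3))`
      (∀ σ₀ : ℝ, 0 < σ₀ → ∃ K : ℝ, ∀ᵐ ω ∂P, ∀ᶠ n : ℕ in atTop,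
        NcutLimit.ncutDev p ν b (σ₀ * (Real.log n / n) ^ (1 / ((d : ℝ) + 3)))
            (fun i : Fin n => X i ω) ≤ K * (Real.log n / n) ^ (α / ((d : ℝ) + 3)) ∧
        NcutLimit.cheegerCutDev p ν b (σ₀ * (Real.log n / n) ^ (1 / ((d : ℝ) + 3)))
            (fun i : Fin n => X i ω) ≤ K * (Real.log n / n) ^ (α / ((d : ℝ) + 3))) ∧
      -- the bias plus deviation bound for arbitrary admissible bandwidths
      (∀ σ : ℕ → ℝ, (∀ᶠ n in atTop, 0 < σ n) → Tendsto σ atTop (𝓝 0) →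
        Tendsto (fun n : ℕ => (n : ℝ) * σ n ^ (d + 1) / Real.log n) atTop atTop →
        ∃ K : ℝ, ∀ᵐ ω ∂P, ∀ᶠ n : ℕ in atTop,
          NcutLimit.ncutDev p ν b (σ n) (fun i : Fin n => X i ω) ≤
            K * (σ n ^ α + Real.sqrt (Real.log n / (n * σ n ^ (d + 1)))) ∧
          NcutLimit.cheegerCutDev p ν b (σ n) (fun i : Fin n => X i ω) ≤
            K * (σ n ^ α + Real.sqrt (Real.log n / (n * σ n ^ (d + 1))))) ∧
      -- optimality: no bandwidth makes this bound smaller than `(log n / n) ^ (1 / (d + 3))`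
      (∀ n : ℕ, 2 ≤ n → ∀ s : ℝ, 0 < s →
        (Real.log n / n) ^ (1 / ((d : ℝ) + 3)) ≤
          s ^ α + Real.sqrt (Real.log n / (n * s ^ (d + 1))))) := by
  obtain ⟨k, rfl⟩ : ∃ k, d = k + 1 := ⟨d - 1, by omega⟩
  have hmP := NcutLimit.measurableSet_halfPos ν b
  have hmN := NcutLimit.measurableSet_halfNeg ν b
  refine ⟨fun σ hσ hσ0 hσn => ?_, fun hfin α hα0 hα1 => ?_⟩
  · have hτP := hp.tendsto_vol_bias hmP hσ hσ0
    have hτN := hp.tendsto_vol_bias hmN hσ hσ0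
    have hτ := hτP.add hτN
    rw [add_zero] at hτ
    obtain ⟨K, -, hK⟩ := NcutLimit.exists_ae_eventually_dev_le hp hXm hXlaw hXind hσ hσ0 hσn hτ (by
      rintro H - (rfl | rfl)
      · exact Eventually.of_forall fun n => le_add_of_nonneg_right (abs_nonneg _)
      · exact Eventually.of_forall fun n => le_add_of_nonneg_left (abs_nonneg _))
    have hr0 : Tendsto (fun n : ℕ => √(Real.log n / (n * σ n ^ (k + 1 + 1)))) atTop (𝓝 0) := by
      have : Tendsto (fun n : ℕ => Real.log n / (n * σ n ^ (k + 1 + 1))) atTop (𝓝 0) := by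
        refine (tendsto_inv_atTop_zero.comp hσn).congr fun n => ?_
        simp
      have h := (Real.continuous_sqrt.tendsto 0).comp this
      rwa [Real.sqrt_zero] at h
    have hlim := ((hσ0.add hr0).add hτ).const_mul K
    simp only [add_zero, mul_zero] at hlim
    filter_upwards [hK] with ω hω
    exact ⟨squeeze_zero' (Eventually.of_forall fun n => abs_nonneg _) (hω.mono fun n h => h.1) hlim,
      squeeze_zero' (Eventually.of_forall fun n => abs_nonneg _) (hω.mono fun n h => h.2) hlim⟩
  · -- since `σ ≤ σ ^ α` for `σ ≤ 1`, the bias `O(σ)` is more than enough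
    have hgen : ∀ σ : ℕ → ℝ, (∀ᶠ n in atTop, 0 < σ n) → Tendsto σ atTop (𝓝 0) →
        Tendsto (fun n : ℕ => (n : ℝ) * σ n ^ (k + 1 + 1) / Real.log n) atTop atTop →
        ∃ K : ℝ, 0 ≤ K ∧ ∀ᵐ ω ∂P, ∀ᶠ n : ℕ in atTop,
          NcutLimit.ncutDev p ν b (σ n) (fun i : Fin n => X i ω) ≤
            K * (σ n ^ α + Real.sqrt (Real.log n / (n * σ n ^ (k + 1 + 1)))) ∧
          NcutLimit.cheegerCutDev p ν b (σ n) (fun i : Fin n => X i ω) ≤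
            K * (σ n ^ α + Real.sqrt (Real.log n / (n * σ n ^ (k + 1 + 1)))) := by
      intro σ hσ hσ0 hσn
      obtain ⟨K₁, hK₁, hP⟩ := hp.exists_vol_bias_le hd hfin hmP
      obtain ⟨K₂, hK₂, hN⟩ := hp.exists_vol_bias_le hd hfin hmN
      obtain ⟨K, hK, hdev⟩ := NcutLimit.exists_ae_eventually_dev_le hp hXm hXlaw hXind hσ hσ0 hσn
        (τ := fun n => (K₁ + K₂) * σ n) (by simpa using hσ0.const_mul (K₁ + K₂)) (by
          rintro H - (rfl | rfl)
          · filter_upwards [hσ] with n hs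
            exact (hP _ hs).trans (by gcongr; linarith)
          · filter_upwards [hσ] with n hs
            exact (hN _ hs).trans (by gcongr; linarith))
      refine ⟨K * (1 + K₁ + K₂), by positivity, ?_⟩
      filter_upwards [hdev] with ω hω
      filter_upwards [hω, hσ, hσ0.eventually_le_const one_pos] with n h hs hs1
      have hα : σ n ≤ σ n ^ α := by
        calc σ n = σ n ^ (1 : ℝ) := (Real.rpow_one _).symm
          _ ≤ σ n ^ α := Real.rpow_le_rpow_of_exponent_ge hs hs1 hα1.le
      have hρ := Real.sqrt_nonneg (Real.log n / (n * σ n ^ (k + 1 + 1)))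
      set ρ := √(Real.log n / (n * σ n ^ (k + 1 + 1)))
      have hle : K * (σ n + ρ + (K₁ + K₂) * σ n) ≤ K * (1 + K₁ + K₂) * (σ n ^ α + ρ) := by
        rw [mul_assoc]
        refine mul_le_mul_of_nonneg_left ?_ hK
        nlinarith [mul_nonneg hK₁ hρ, mul_nonneg hK₂ hρ]
      exact ⟨h.1.trans hle, h.2.trans hle⟩
    refine ⟨fun σ₀ hσ₀ => ?_, fun σ hσ hσ0 hσn => ?_, fun n hn s hs => ?_⟩
    · have hxpos : ∀ n : ℕ, 2 ≤ n → 0 < Real.log n / n := fun n hn => by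
        have hn0 : (0 : ℝ) < n := by exact_mod_cast (by omega : 0 < n)
        have hlog : 0 < Real.log n := Real.log_pos (by exact_mod_cast (by omega : 1 < n))
        positivity
      have he : 0 < 1 / (((k + 1 : ℕ) : ℝ) + 3) := by positivity
      have hy0 : Tendsto (fun n : ℕ => (Real.log n / n) ^ (1 / (((k + 1 : ℕ) : ℝ) + 3)))
          atTop (𝓝 0) := by
        have := NcutLimit.tendsto_log_div_self.rpow_const (p := 1 / (((k + 1 : ℕ) : ℝ) + 3))
          (Or.inr he.le)
        rwa [Real.zero_rpow he.ne'] at this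
      obtain ⟨K, hK, H⟩ := hgen (fun n => σ₀ * (Real.log n / n) ^ (1 / (((k + 1 : ℕ) : ℝ) + 3)))
        (by
          filter_upwards [eventually_ge_atTop 2] with n hn
          have := hxpos n hn
          positivity)
        (by simpa using hy0.const_mul σ₀)
        (by
          have hsq : Tendsto (fun n : ℕ => (σ₀ ^ (k + 1 + 1))⁻¹ *
              ((Real.log n / n) ^ (1 / (((k + 1 : ℕ) : ℝ) + 3))) ^ 2) atTop (𝓝[>] 0) := by
            refine tendsto_nhdsWithin_iff.mpr ⟨by simpa using (hy0.pow 2).const_mul _, ?_⟩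
            filter_upwards [eventually_ge_atTop 2] with n hn
            have := hxpos n hn
            rw [Set.mem_Ioi]
            positivity
          refine hsq.inv_tendsto_nhdsGT_zero.congr' ?_
          filter_upwards [eventually_ge_atTop 2] with n hn
          rw [Pi.inv_apply, ← NcutLimit.log_div_mul_pow_eq (k + 1) hσ₀ hn, inv_div])
      refine ⟨K * (σ₀ ^ α + √((σ₀ ^ (k + 1 + 1))⁻¹)), ?_⟩
      filter_upwards [H] with ω hω
      filter_upwards [hω, eventually_ge_atTop 2] with n h hn
      have hx0 := hxpos n hn
      have hx1 := (NcutLimit.log_div_self_lt_one hn).le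
      rw [NcutLimit.log_div_mul_pow_eq (k + 1) hσ₀ hn, Real.mul_rpow hσ₀.le (by positivity),
        ← Real.rpow_mul hx0.le, Real.sqrt_mul (by positivity), Real.sqrt_sq (by positivity),
        one_div_mul_eq_div] at h
      have hle : K * (σ₀ ^ α * (Real.log n / n) ^ (α / (((k + 1 : ℕ) : ℝ) + 3)) +
          √((σ₀ ^ (k + 1 + 1))⁻¹) * (Real.log n / n) ^ (1 / (((k + 1 : ℕ) : ℝ) + 3))) ≤
          K * (σ₀ ^ α + √((σ₀ ^ (k + 1 + 1))⁻¹)) *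
            (Real.log n / n) ^ (α / (((k + 1 : ℕ) : ℝ) + 3)) := by
        rw [mul_assoc, add_mul]
        have : (Real.log n / n) ^ (1 / (((k + 1 : ℕ) : ℝ) + 3)) ≤
            (Real.log n / n) ^ (α / (((k + 1 : ℕ) : ℝ) + 3)) :=
          Real.rpow_le_rpow_of_exponent_ge hx0 hx1 (by gcongr)
        gcongr
      exact ⟨h.1.trans hle, h.2.trans hle⟩
    · obtain ⟨K, -, H⟩ := hgen σ hσ hσ0 hσn
      exact ⟨K, H⟩
    · exact NcutLimit.rpow_le_bias_add_deviation (k + 1) hα0 hα1 hn hs
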